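/- Work over $\mathbb C$. Let $Red(4)\subset G(3,\mathfrak{sl}_4)$ be the Zariski closure, in the Grassmannian of $3$-dimensional subspaces of $\mathfrak{sl}_4$, of the set of Cartan subalgebras of $\mathfrak{sl}_4$. For $m\in\{1,3\}$ and an $m$-dimensional subspace $E\subset\mathbb C^4$ let $\mathfrak a_E\subset\mathfrak{sl}_4$ be the space of endomorphisms whose image is contained in $E$ and whose kernel contains $E$; the minimal orbits are $\mathcal O'=\{\mathfrak a_E:\dim E=1\}\simeq\mathbb P^3$ and $\mathcal O''=\{\mathfrak a_E:\dim E=3\}\simeq\check{\mathbb P}^3$. Write $\mathbb C^4=U\oplus\mathbb C e_4$ with $U=\mathbb C^3$. Near $\mathfrak a_U$ the Grassmannian has the affine chart whose points are the spaces of matrices $$\begin{pmatrix}A(u)&u\\ \alpha(u)&-\operatorname{tr}A(u)\end{pmatrix},\qquad u\in U,$$ with $A\in\mathrm{Hom}(U,\mathrm{End}\,U)$ and $\alpha\in\mathrm{Hom}(U,U^*)$, in which $\mathfrak a_U$ is the origin. Let $N$ be the normal slice to $\mathcal O''$ at $\mathfrak a_U$ given by $\operatorname{tr}A(u)=0$ for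 all $u$. Let $W$ be the space of traceless symmetric maps, that is, of the $B\in\mathrm{Hom}(U,\mathrm{End}\,U)$ such that $B(u)v=B(v)u$ and $\operatorname{tr}B(u)=0$ for all $u,v\in U$; we regard $W$ as a subspace of the chart by $A=B$, $\alpha=0$. Then $\dim W=15$, so $\mathbb P W=\mathbb P^{14}$, and there is a linear isomorphism $T:\Lambda^2S^2U^*\to W$ such that $$T(e^2\wedge f^2)(u)(u)=e(u)f(u)\;e\wedge f\qquad(e,f\in U^*,\ u\in U),$$ where $\Lambda^2U^*$ is identified with $U$ by the standard volume form. It is equivariant: $T(g\omega)=\det(g)^{-1}\,g\,T(\omega)$ for $g\in GL(U)$ and $\omega\in\Lambda^2S^2U^*$. Moreover every point $\mathfrak a$ of $\mathcal O'\cup\mathcal O''$ lies in $Red(4)$ and is of the form $\varphi(\mathfrak a_U)$ for some automorphism $\varphi$ of the Lie algebra $\mathfrak{sl}_4$. For every such $\varphi$, consider the tangent cone at $\mathfrak a$ to the intersection of $Red(4)$ with the normal slice $\varphi(N)$, in the coordinates $(A,\alpha)$ of the chart transported by $\varphi$. Its ideal, generated by the initial forms of the polynomials that vanish on this intersection, is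 prime, and it defines a projective variety $C_4$ of dimension $8$. This variety is contained in $\mathbb P W=\mathbb P^{14}$, and the projective isomorphism $\mathbb P(\Lambda^2S^2U^*)\to\mathbb P W$ induced by $T$ maps the Grassmannian $G(2,S^2U^*)\simeq G(2,6)$ of pencils of plane conics, in its Plücker embedding, onto $C_4$. In particular $C_4\subset\mathbb P^{14}$ is projectively equivalent to $G(2,6)$. -/

import Mathlib

open scoped LinearAlgebra.Projectivization Matrix
open MvPolynomial (vanishingIdeal zeroLocus homogeneousComponent)

noncomputable section

namespace ReductionVariety

/-! ### Zariski closure in a Grassmannian, and the variety of reductions -/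

/-- The Plücker vector of a basis `b` of a subspace `L` of `V`: the decomposable multivector
`b 0 ∧ ... ∧ b (r - 1)` in the exterior power of degree `r` of `V`. -/
def pluckerVector {V : Type*} [AddCommGroup V] [Module ℂ V] {r : ℕ} {L : Submodule ℂ V}
    (b : Module.Basis (Fin r) ℂ L) : ⋀[ℂ]^r V :=
  exteriorPower.ιMulti ℂ r (fun i => (b i : V))

/-- The polynomial function given by `F` on the exterior power of degree `r` of `V` vanishes at
the Plücker point of `L`. Polynomial functions on a vector space `E` are written as polynomials
in the linear forms on `E`. -/
def VanishesAt {V : Type*} [AddCommGroup V] [Module ℂ V] {r : ℕ}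
    (F : MvPolynomial (Module.Dual ℂ (⋀[ℂ]^r V)) ℂ) (L : Submodule ℂ V) : Prop :=
  ∀ b : Module.Basis (Fin r) ℂ L, MvPolynomial.eval (fun l => l (pluckerVector b)) F = 0

/-- The Zariski closure, in the Grassmannian `G(r, V)`, of a set `S` of `r`-dimensional subspaces
of `V`: all `r`-dimensional subspaces at which every homogeneous polynomial in the Plücker
coordinates that vanishes on `S` vanishes too. -/
def grassmannianClosure {V : Type*} [AddCommGroup V] [Module ℂ V] (r : ℕ)
    (S : Set (Submodule ℂ V)) : Set (Submodule ℂ V) :=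
  {L | Module.finrank ℂ L = r ∧
    ∀ (d : ℕ) (F : MvPolynomial (Module.Dual ℂ (⋀[ℂ]^r V)) ℂ), F.IsHomogeneous d →
      (∀ K ∈ S, VanishesAt F K) → VanishesAt F L}

/-- The Lie algebra of traceless matrices with rows and columns indexed by `ι`. -/
abbrev Sl (ι : Type) [Fintype ι] [DecidableEq ι] : Type :=
  LieAlgebra.SpecialLinear.sl ι ℂ

/-- The set of non singular reductions: the Cartan subalgebras of `sl_n`, seen as points of
the Grassmannian `G(n - 1, sl_n)`. -/
def redOpen (ι : Type) [Fintype ι] [DecidableEq ι] : Set (Submodule ℂ (Sl ι)) :=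
  {L | Module.finrank ℂ L = Fintype.card ι - 1 ∧
    ∃ H : LieSubalgebra ℂ (Sl ι), H.IsCartanSubalgebra ∧ H.toSubmodule = L}

/-- The variety of reductions `Red(n)`: the Zariski closure of the set of Cartan subalgebras
of `sl_n` in the Grassmannian `G(n - 1, sl_n)`. -/
def red (ι : Type) [Fintype ι] [DecidableEq ι] : Set (Submodule ℂ (Sl ι)) :=
  grassmannianClosure (Fintype.card ι - 1) (redOpen ι)

/-! ### The minimal orbits -/

/-- The three-dimensional space `U`. -/
abbrev U : Type := Fin 3 → ℂ

/-- Index set of the coordinates of the four-dimensional space `U ⊕ ℂ e`. -/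
abbrev I4 : Type := Fin 3 ⊕ Unit

/-- The spaces of endomorphisms of the four-dimensional space whose image is contained in, and
whose kernel contains, a fixed subspace `E` of dimension `m`. For `m = 1` and for `m = 3` these
are the two minimal orbits, a projective three-space and its dual. -/
def minimalOrbit (m : ℕ) : Set (Submodule ℂ (Sl I4)) :=
  {a | ∃ E : Submodule ℂ (I4 → ℂ), Module.finrank ℂ E = m ∧
    ∀ X : Sl I4, X ∈ a ↔
      LinearMap.range (Matrix.toLin' X.val) ≤ E ∧ E ≤ LinearMap.ker (Matrix.toLin' X.val)}

/-! ### The affine chart of `G(3, sl_4)` around a point of the minimal orbit -/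

/-- Index set of the coordinates of the chart: `Sum.inl (k, i, j)` is the entry `(i, j)` of
the matrix `A(e_k)`, and `Sum.inr (k, j)` is the coordinate `j` of the linear form `α(e_k)`, where
`A` is a linear map from `U` to `End U` and `α` is a linear map from `U` to its dual. -/
abbrev ChartIndex : Type := (Fin 3 × Fin 3 × Fin 3) ⊕ (Fin 3 × Fin 3)

/-- The matrix `A(u)`. -/
def chartA (c : ChartIndex → ℂ) (u : U) : Matrix (Fin 3) (Fin 3) ℂ :=
  Matrix.of fun i j => ∑ k, u k * c (Sum.inl (k, i, j))

/-- The linear form `α(u)`. -/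
def chartAlpha (c : ChartIndex → ℂ) (u : U) : Fin 3 → ℂ :=
  fun j => ∑ k, u k * c (Sum.inr (k, j))

/-- The traceless block matrix with rows `(A(u), u)` and `(α(u), - trace A(u))`. -/
def chartMatrix (c : ChartIndex → ℂ) (u : U) : Matrix I4 I4 ℂ :=
  Matrix.fromBlocks (chartA c u) (Matrix.replicateCol Unit u)
    (Matrix.replicateRow Unit (chartAlpha c u)) (Matrix.of fun _ _ => -(chartA c u).trace)

theorem chartMatrix_mem (c : ChartIndex → ℂ) (u : U) :
    chartMatrix c u ∈ LieAlgebra.SpecialLinear.sl I4 ℂ := by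
  have h : (chartMatrix c u).trace = 0 := by
    simp [chartMatrix, Matrix.trace]
  simpa [LieAlgebra.SpecialLinear.sl] using h

/-- The point of `G(3, sl_4)` with chart coordinates `c`: the space of the matrices
`chartMatrix c u`, where `u` runs through `U`. The coordinates `c = 0` give the point of
the minimal orbit that consists of the matrices whose image is contained in, and whose kernel
contains, the hyperplane `U`. -/
def chartPoint (c : ChartIndex → ℂ) : Submodule ℂ (Sl I4) :=
  Submodule.span ℂ (Set.range fun u : U => (⟨chartMatrix c u, chartMatrix_mem c u⟩ : Sl I4))

/-- The normal slice, in chart coordinates: the linear subspace of dimension 33 on which the trace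
of `A(u)` is zero for all `u`. In the chart, the tangent space at `0` to the minimal
orbit is the space of all `A(u) = u ⊗ ψ`, `α = 0`, where `ψ` is a linear form on `U`; it is
a complement of this subspace. -/
def normalSlice : Submodule ℂ (ChartIndex → ℂ) where
  carrier := {c | ∀ u, (chartA c u).trace = 0}
  zero_mem' := by
    intro u
    simp [chartA, Matrix.trace]
  add_mem' := by
    intro c d hc hd u
    have h : chartA (c + d) u = chartA c u + chartA d u := by
      ext i j
      simp [chartA, mul_add, Finset.sum_add_distrib]
    rw [h, Matrix.trace_add, hc u, hd u, add_zero]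
  smul_mem' := by
    intro t c hc u
    have h : chartA (t • c) u = t • chartA c u := by
      ext i j
      simp [chartA, Finset.mul_sum, mul_left_comm]
    rw [h, Matrix.trace_smul, hc u, smul_zero]

/-- The intersection of `Red(4)` with the image, under an automorphism `φ` of the Lie algebra
`sl_4`, of the normal slice, in chart coordinates. The image slice is a normal slice at the point
`φ (chartPoint 0)`. -/
def redSlice (φ : Sl I4 ≃ₗ⁅ℂ⁆ Sl I4) : Set (ChartIndex → ℂ) :=
  {c | c ∈ normalSlice ∧ (chartPoint c).map (φ : Sl I4 →ₗ[ℂ] Sl I4) ∈ red I4}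

/-! ### Tangent cones -/

/-- The ideal of the tangent cone at `x` of a closed subset `X` of an affine space: it is
generated by the initial forms (homogeneous components of lowest degree) of the polynomials that
vanish on the translate `X - x`. -/
def tangentConeIdeal {σ : Type} (X : Set (σ → ℂ)) (x : σ → ℂ) : Ideal (MvPolynomial σ ℂ) :=
  Ideal.span {g | ∃ f ∈ vanishingIdeal ℂ ((fun y => y - x) '' X), ∃ d : ℕ,
    (∀ e < d, homogeneousComponent e f = 0) ∧ g = homogeneousComponent d f}

/-- The tangent cone at `x` of a closed subset `X` of an affine space. -/
def tangentCone {σ : Type} (X : Set (σ → ℂ)) (x : σ → ℂ) : Set (σ → ℂ) :=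
  zeroLocus ℂ (tangentConeIdeal X x)

/-- The projective variety defined by the homogeneous ideal `I` has dimension `d`: the Krull
dimension of its homogeneous coordinate ring is `d + 1`. -/
def HasProjectiveDimension {σ : Type} (I : Ideal (MvPolynomial σ ℂ)) (d : ℕ) : Prop :=
  ringKrullDim (MvPolynomial σ ℂ ⧸ I) = ((d + 1 : ℕ) : WithBot ℕ∞)

/-! ### Traceless symmetric maps -/

/-- The space of traceless symmetric maps `B` from `U` to `End U`: those with `B(u)v = B(v)u` and
`trace B(u) = 0` for all `u`, `v`. Endomorphisms of `U` are written as matrices. -/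
def tracelessSym : Submodule ℂ (U →ₗ[ℂ] Matrix (Fin 3) (Fin 3) ℂ) where
  carrier := {B | (∀ u v, B u *ᵥ v = B v *ᵥ u) ∧ ∀ u, (B u).trace = 0}
  zero_mem' := by simp
  add_mem' := by
    rintro B C ⟨hB, hB0⟩ ⟨hC, hC0⟩
    exact ⟨fun u v => by simp [Matrix.add_mulVec, hB u v, hC u v], fun u => by simp [hB0 u, hC0 u]⟩
  smul_mem' := by
    rintro t B ⟨hB, hB0⟩
    exact ⟨fun u v => by simp [Matrix.smul_mulVec, hB u v], fun u => by simp [hB0 u]⟩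

/-- The inclusion of the space of traceless symmetric maps in the chart, `A = B` and `α = 0`. -/
def toChart : tracelessSym →ₗ[ℂ] (ChartIndex → ℂ) where
  toFun B := Sum.elim (fun p => B.val (Pi.single p.1 1) p.2.1 p.2.2) (fun _ => 0)
  map_add' B C := by
    ext (p | p) <;> simp
  map_smul' t B := by
    ext (p | p) <;> simp

/-- The projectivized tangent cone `C_4` to the normal slice, as a subset of the projective space
of the space of traceless symmetric maps. -/
def C4 (φ : Sl I4 ≃ₗ⁅ℂ⁆ Sl I4) : Set (ℙ ℂ tracelessSym) :=
  {x | ∀ B ∈ x.submodule, toChart B ∈ tangentCone (redSlice φ) 0}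

/-! ### Conics, pencils of conics, and the group action -/

/-- The space of quadratic forms on `U`, that is, the second symmetric power of the dual. -/
abbrev Conics : Type := QuadraticForm ℂ U

/-- The square of a linear form. -/
def sqForm (e : Module.Dual ℂ U) : Conics := QuadraticMap.linMulLin e e

/-- The wedge product of two linear forms on `U`, as a vector of `U` through the identification of
the second exterior power of the dual with `U` given by the standard volume form. -/
def wedgeVec (e f : Module.Dual ℂ U) : U :=
  crossProduct (fun i => e (Pi.single i 1)) (fun i => f (Pi.single i 1))

/-- The bivector `p ∧ q`. -/
def wedgeConics (p q : Conics) : ⋀[ℂ]^2 Conics := exteriorPower.ιMulti ℂ 2 ![p, q]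

/-- The Grassmannian of pencils of conics in its Plücker embedding. -/
def pencils : Set (ℙ ℂ (⋀[ℂ]^2 Conics)) :=
  {x | ∃ p q : Conics, LinearIndependent ℂ ![p, q] ∧
    x.submodule = Submodule.span ℂ {wedgeConics p q}}

/-- The action of `g` on quadratic forms, `(g q)(u) = q(g⁻¹ u)`. -/
def actConics (g : U ≃ₗ[ℂ] U) : Conics →ₗ[ℂ] Conics where
  toFun q := q.comp (g.symm : U →ₗ[ℂ] U)
  map_add' p q := by
    ext u
    simp
  map_smul' t q := by
    ext u
    simp

end ReductionVariety

end

open ReductionVariety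

open scoped LinearAlgebra.Projectivization Matrix
open MvPolynomial (vanishingIdeal zeroLocus homogeneousComponent)

noncomputable section

namespace ReductionVariety

/-! ### Coordinates on bivectors of conics and on traceless symmetric maps -/

/-! The set `red I4` is stable under automorphisms of the Lie algebra, so `φ` plays no role and
everything is a computation in the chart at the origin. Minus the transpose exchanges the two
minimal orbits, and conjugation is transitive on each.

Commutativity of a subspace is a linear condition on its Plücker vector, and Cartan subalgebras
commute, so every point of the closure is commutative. For a point (A, α) of the slice, the two
upper blocks of the commutator say that A(u)v = A(v)u and that A(u)A(v) + u ⊗ α(v) is symmetric in u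
and v. Contracting the second equation and using tr A = 0 gives 2α(u)(v) = tr A(u)A(v). Hence A lies
in W and α is a quadratic function of A. Identify W with bivectors of conics through B(u)v = ½(p(u)
× q(v) + p(v) × q(u)) for p ∧ q, where p(u) is the linear form obtained by contracting p with u. In
these coordinates, fifteen combinations of the remaining equations are exactly the Plücker relations
(`pluckerRel_minorsOf`), so the bivector is decomposable.

Conversely, a decomposable bivector gives a commuting space (`chartBasisMatrix_sliceCoord_commute`).
It is a Cartan subalgebra when the trace form on it is nondegenerate, and a line of pairs of conics
through one nondegenerate example shows that it always lies in the closure.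

Therefore the slice is the graph of a quadratic map over the affine cone over G(2,6), and its
tangent cone is that cone (`tangentConeIdeal_graphOver`). The ideal is the kernel of a homomorphism
into a polynomial ring, hence prime. Nine Plücker coordinates form a transcendence basis of the
coordinate ring, which gives projective dimension 8. Equivariance follows from the behaviour of the
cross product under a linear map. -/

/-- The position of the entry `(i, j)` in the list of the six entries of a symmetric matrix of
size three. -/
def symIdx : Fin 3 → Fin 3 → Fin 6 := ![![0, 5, 4], ![5, 1, 3], ![4, 3, 2]]

theorem symIdx_comm (i j : Fin 3) : symIdx i j = symIdx j i := by
  revert i j; decide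

/-- The Plücker coordinates of a pair of vectors. -/
def minor {ι R : Type*} [CommRing R] (p q : ι → R) (a b : ι) : R := p a * q b - p b * q a

theorem minor_skew {ι R : Type*} [CommRing R] (p q : ι → R) (a b : ι) :
    minor p q a b = -minor p q b a := by
  unfold minor; ring

section Generic

variable {R : Type*} [CommRing R]

/-- The Plücker coordinates of the bivector of conics that corresponds to the traceless symmetric
map with entries `b`. -/
def minorsOf (b : Fin 3 → Fin 3 → Fin 3 → R) : Fin 6 → Fin 6 → R :=
  ![![0, 2 * b 0 1 2, -(2 * b 0 2 1), -(2 * b 0 1 1 + b 0 0 0), -b 0 0 1, b 0 0 2],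
    ![-(2 * b 0 1 2), 0, 2 * b 1 2 0, b 1 1 0, 2 * b 0 1 0 + b 1 1 1, -b 1 1 2],
    ![2 * b 0 2 1, -(2 * b 1 2 0), 0, -b 2 2 0, b 2 2 1, 2 * b 1 2 1 + b 2 2 2],
    ![2 * b 0 1 1 + b 0 0 0, -b 1 1 0, b 2 2 0, 0, -b 2 2 2, b 1 1 1],
    ![b 0 0 1, -(2 * b 0 1 0 + b 1 1 1), -b 2 2 1, b 2 2 2, 0, -b 0 0 0],
    ![-b 0 0 2, b 1 1 2, -(2 * b 1 2 1 + b 2 2 2), -b 1 1 1, b 0 0 0, 0]]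

theorem minorsOf_skew (b : Fin 3 → Fin 3 → Fin 3 → R) (x y : Fin 6) :
    minorsOf b x y = -minorsOf b y x := by
  fin_cases x <;> fin_cases y <;> simp [minorsOf]

variable [Algebra ℂ R]

/-- The coordinate `k` of the vector `B(e_i) e_j`, where `B` is the traceless symmetric map that
corresponds to the bivector of conics with Plücker coordinates `m`. -/
def coneEntry (m : Fin 6 → Fin 6 → R) (i j k : Fin 3) : R :=
  algebraMap ℂ R (1 / 2) * (m (symIdx (k + 1) i) (symIdx (k + 2) j)
    + m (symIdx (k + 1) j) (symIdx (k + 2) i))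

theorem coneEntry_comm (m : Fin 6 → Fin 6 → R) (i j k : Fin 3) :
    coneEntry m i j k = coneEntry m j i k := by
  unfold coneEntry; ring

theorem two_mul_half (x : R) : 2 * (algebraMap ℂ R (1 / 2) * x) = x := by
  have h : (2 : R) * algebraMap ℂ R (1 / 2) = 1 := by
    rw [← map_ofNat (algebraMap ℂ R) 2, ← map_mul]; norm_num
  linear_combination x * h

theorem half_mul_two (x : R) : algebraMap ℂ R (1 / 2) * (2 * x) = x := by
  linear_combination two_mul_half x

theorem eq_of_two_mul_eq {x y : R} (h : 2 * x = 2 * y) : x = y := by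
  rw [← half_mul_two x, h, half_mul_two]

theorem two_mul_coneEntry (m : Fin 6 → Fin 6 → R) (i j k : Fin 3) :
    2 * coneEntry m i j k = m (symIdx (k + 1) i) (symIdx (k + 2) j)
      + m (symIdx (k + 1) j) (symIdx (k + 2) i) :=
  two_mul_half _

/-- By skewness and the symmetry of `symIdx`, each diagonal term is a difference between a function
of k and its value at k + 1, so the sum telescopes around the cycle. -/
theorem coneEntry_trace (m : Fin 6 → Fin 6 → R) (hm : ∀ a b, m a b = -m b a) (i : Fin 3) :
    ∑ k, coneEntry m i k k = 0 := by
  have h : ∀ k : Fin 3, 2 * coneEntry m i k k = m (symIdx (k + 1) i) (symIdx (k + 2) k)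
      - m (symIdx (k + 1 + 1) i) (symIdx (k + 1 + 2) (k + 1)) := by
    intro k
    rw [two_mul_coneEntry, hm (symIdx (k + 1) k)]
    have h1 : k + 1 + 1 = k + 2 := by revert k; decide
    have h2 : k + 1 + 2 = k := by revert k; decide
    rw [h1, h2, symIdx_comm (k + 1) k]; ring
  apply eq_of_two_mul_eq
  rw [Finset.mul_sum, Finset.sum_congr rfl fun k _ => h k, Finset.sum_sub_distrib, mul_zero,
    sub_eq_zero]
  exact (Equiv.sum_comp (Equiv.addRight (1 : Fin 3))
    fun k => m (symIdx (k + 1) i) (symIdx (k + 2) k)).symm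

/-- Together with `coneEntry_minorsOf` this makes skew 6 × 6 arrays and traceless symmetric maps two
linear coordinate systems on one 15-dimensional space. It is stated over any ℂ-algebra because it is
also needed for generic coordinates. -/
theorem minorsOf_coneEntry (m : Fin 6 → Fin 6 → R) (hm : ∀ a b, m a b = -m b a) (x y : Fin 6) :
    minorsOf (coneEntry m) x y = m x y := by
  have h0 : ∀ a, m a a = 0 := fun a => eq_of_two_mul_eq (by linear_combination hm a a)
  have key : ∀ x y : Fin 6, x ≤ y → minorsOf (coneEntry m) x y = m x y := by
    intro x y hxy
    have e := two_mul_coneEntry m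
    have e111 := e 0 0 0
    have e112 := e 0 0 1
    have e113 := e 0 0 2
    have e221 := e 1 1 0
    have e222 := e 1 1 1
    have e223 := e 1 1 2
    have e331 := e 2 2 0
    have e332 := e 2 2 1
    have e333 := e 2 2 2
    have e123 := e 0 1 2
    have e132 := e 0 2 1
    have e231 := e 1 2 0
    have e121 := e 0 1 0
    have e122 := e 0 1 1
    have e232 := e 1 2 1
    simp [symIdx] at e111 e112 e113 e221 e222 e223 e331 e332 e333 e123 e132 e231 e121 e122 e232
    apply eq_of_two_mul_eq
    fin_cases x <;> fin_cases y <;> first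
      | exact absurd hxy (by decide)
      | (simp [minorsOf, h0]; done)
      | skip
    all_goals simp [minorsOf]
    · linear_combination 2 * e123 + 2 * h0 5
    · linear_combination -2 * e132 - 2 * h0 4 - 2 * hm 0 2
    · linear_combination -2 * e122 - e111 - 2 * hm 0 3 - 2 * hm 4 5
    · linear_combination -e112 - 2 * hm 0 4
    · linear_combination e113
    · linear_combination 2 * e231 + 2 * h0 3
    · linear_combination e221
    · linear_combination 2 * e121 + e222 + 2 * hm 3 5
    · linear_combination -e223 - 2 * hm 1 5
    · linear_combination -e331 - 2 * hm 2 3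
    · linear_combination e332
    · linear_combination 2 * e232 + e333 + 2 * hm 3 4
    · linear_combination -e333 - 2 * hm 3 4
    · linear_combination e222
    · linear_combination -e111 - 2 * hm 4 5
  rcases le_total x y with h | h
  · exact key x y h
  · rw [minorsOf_skew, key y x h, hm x y]

end Generic

/-! ### Decomposable bivectors -/

/-- The three-term Plücker relation. -/
def pluckerRel {ι R : Type*} [CommRing R] (m : ι → ι → R) (a b c d : ι) : R :=
  m a b * m c d - m a c * m b d + m a d * m b c

theorem pluckerRel_minor {ι R : Type*} [CommRing R] (p q : ι → R) (a b c d : ι) :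
    pluckerRel (minor p q) a b c d = 0 := by
  unfold pluckerRel minor; ring

/-- The three-term Plücker relations need only be checked on increasing indices. -/
theorem pluckerRel_eq_zero {ι : Type*} [LinearOrder ι] (m : ι → ι → ℂ)
    (hm : ∀ a b, m a b = -m b a)
    (h : ∀ a b c d, a < b → b < c → c < d → pluckerRel m a b c d = 0) (a b c d : ι) :
    pluckerRel m a b c d = 0 := by
  have h0 : ∀ a, m a a = 0 := fun a => self_eq_neg.mp (hm a a)
  -- For skew m the relation changes sign under each adjacent transposition, so it vanishes on
  -- repeated neighbours and sorting the indices reduces to the increasing case.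
  have s12 : ∀ a b c d, pluckerRel m a b c d = -pluckerRel m b a c d := by
    intro a b c d
    simp only [pluckerRel, hm b a]; ring
  have s23 : ∀ a b c d, pluckerRel m a b c d = -pluckerRel m a c b d := by
    intro a b c d
    simp only [pluckerRel, hm c b]; ring
  have s34 : ∀ a b c d, pluckerRel m a b c d = -pluckerRel m a b d c := by
    intro a b c d
    simp only [pluckerRel, hm d c]; ring
  have z12 : ∀ a c d, pluckerRel m a a c d = 0 := fun a c d => self_eq_neg.mp (s12 a a c d)
  have z23 : ∀ a b d, pluckerRel m a b b d = 0 := fun a b d => self_eq_neg.mp (s23 a b b d)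
  have z34 : ∀ a b c, pluckerRel m a b c c = 0 := fun a b c => self_eq_neg.mp (s34 a b c c)
  have h4 : ∀ a b c d, a < b → b < c → pluckerRel m a b c d = 0 := by
    intro a b c d hab hbc
    rcases lt_trichotomy c d with hcd | rfl | hcd
    · exact h a b c d hab hbc hcd
    · exact z34 a b c
    rw [s34, neg_eq_zero]
    rcases lt_trichotomy b d with hbd | rfl | hbd
    · exact h a b d c hab hbd hcd
    · exact z23 a b c
    rw [s23, neg_eq_zero]
    rcases lt_trichotomy a d with had | rfl | had
    · exact h a d b c had hbd hbc
    · exact z12 a b c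
    rw [s12, neg_eq_zero]
    exact h d a b c had hab hbc
  have h3 : ∀ a b c d, a < b → pluckerRel m a b c d = 0 := by
    intro a b c d hab
    rcases lt_trichotomy b c with hbc | rfl | hbc
    · exact h4 a b c d hab hbc
    · exact z23 a b d
    rw [s23, neg_eq_zero]
    rcases lt_trichotomy a c with hac | rfl | hac
    · exact h4 a c b d hac hbc
    · exact z12 a b d
    rw [s12, neg_eq_zero]
    exact h4 c a b d hac hab
  rcases lt_trichotomy a b with hab | rfl | hab
  · exact h3 a b c d hab
  · exact z12 a c d
  · rw [s12, neg_eq_zero]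
    exact h3 b a c d hab

/-- A bivector that satisfies the three-term Plücker relations is decomposable. -/
theorem exists_eq_minor {ι : Type*} (m : ι → ι → ℂ)
    (h : ∀ a b c d, pluckerRel m a b c d = 0) : ∃ p q : ι → ℂ, m = minor p q := by
  by_cases h0 : ∀ a b, m a b = 0
  · exact ⟨0, 0, by ext a b; simp [h0, minor]⟩
  push Not at h0
  obtain ⟨a, b, hab⟩ := h0
  -- The rows a and b of m span the plane; dividing one of them by the nonzero entry m a b
  -- normalizes their wedge product to m.
  refine ⟨m a, fun c => m b c / m a b, ?_⟩
  ext c d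
  have := h a b c d
  unfold pluckerRel at this
  unfold minor
  field_simp
  linear_combination this

/-! ### The equations of commuting pairs -/

theorem coneEntry_minorsOf (b : Fin 3 → Fin 3 → Fin 3 → ℂ) (hs : ∀ i j k, b i j k = b j i k)
    (ht : ∀ i, ∑ k, b i k k = 0) (i j k : Fin 3) :
    coneEntry (minorsOf b) i j k = b i j k := by
  simp only [Fin.sum_univ_three] at ht
  have t0 := ht 0
  have t1 := ht 1
  have t2 := ht 2
  have s0 := hs 1 0
  have s1 := hs 2 0
  have s2 := hs 2 1
  apply eq_of_two_mul_eq
  rw [two_mul_coneEntry]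
  fin_cases i <;> fin_cases j <;> fin_cases k <;> simp [symIdx, minorsOf] <;> grind

/-- The linear form part of a commuting chart point is determined by the endomorphism part. -/
theorem two_mul_alpha (b : Fin 3 → Fin 3 → Fin 3 → ℂ) (α : Fin 3 → Fin 3 → ℂ)
    (hs : ∀ i j k, b i j k = b j i k) (ht : ∀ i, ∑ k, b i k k = 0)
    (E : ∀ i j k l, ∑ x, b i x k * b j l x - ∑ x, b j x k * b i l x =
      (if k = j then α i l else 0) - (if k = i then α j l else 0)) (j l : Fin 3) :
    2 * α j l = ∑ i, ∑ x, b j x i * b l i x := by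
  have h1 : ∑ i, ∑ x, b i x i * b j l x = 0 := by
    rw [Finset.sum_comm]
    refine Finset.sum_eq_zero fun x _ => ?_
    rw [← Finset.sum_mul, Finset.sum_congr rfl fun i _ => hs i x i, ht, zero_mul]
  have h2 : ∑ i, ∑ x, b j x i * b i l x = ∑ i, ∑ x, b j x i * b l i x :=
    Finset.sum_congr rfl fun i _ => Finset.sum_congr rfl fun x _ => by rw [hs i l]
  -- Set k = i in the commutator equation and sum over i: the first product vanishes by
  -- tracelessness, and the right side becomes α − 3α = −2α.
  have h3 := Finset.sum_congr (rfl : (Finset.univ : Finset (Fin 3)) = _) fun i _ => E i j i l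
  rw [Finset.sum_sub_distrib, Finset.sum_sub_distrib, h1, h2] at h3
  simp only [Finset.sum_ite_eq', Finset.mem_univ, if_true, Finset.sum_const, Finset.card_univ,
    Fintype.card_fin, nsmul_eq_mul] at h3
  push_cast at h3
  linear_combination h3

/-- The computational heart of one direction. Once α is replaced by half the trace form, fifteen
entries of the commutator equation suffice: each of the fifteen Plücker relations is a linear
combination of at most two of them. -/
theorem pluckerRel_minorsOf (b : Fin 3 → Fin 3 → Fin 3 → ℂ)
    (hs : ∀ i j k, b i j k = b j i k) (ht : ∀ i, ∑ k, b i k k = 0)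
    (E : ∀ i j k l, ∑ x, b i x k * b j l x - ∑ x, b j x k * b i l x =
      (if k = j then (∑ y, ∑ x, b i x y * b l y x) / 2 else 0)
        - (if k = i then (∑ y, ∑ x, b j x y * b l y x) / 2 else 0)) (a₁ a₂ a₃ a₄ : Fin 6) :
    pluckerRel (minorsOf b) a₁ a₂ a₃ a₄ = 0 := by
  have t0 : b 0 2 2 = -b 0 0 0 - b 0 1 1 := by
    have := ht 0
    rw [Fin.sum_univ_three] at this
    linear_combination this
  have t1 : b 1 2 2 = -b 0 1 0 - b 1 1 1 := by
    have := ht 1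
    rw [Fin.sum_univ_three, hs 1 0] at this
    linear_combination this
  have t2 : b 0 2 0 = -b 1 2 1 - b 2 2 2 := by
    have := ht 2
    rw [Fin.sum_univ_three, hs 2 0, hs 2 1] at this
    linear_combination this
  have e0100 := E 0 1 0 0
  have e0101 := E 0 1 0 1
  have e0102 := E 0 1 0 2
  have e0110 := E 0 1 1 0
  have e0111 := E 0 1 1 1
  have e0112 := E 0 1 1 2
  have e0120 := E 0 1 2 0
  have e0121 := E 0 1 2 1
  have e0200 := E 0 2 0 0
  have e0201 := E 0 2 0 1
  have e0202 := E 0 2 0 2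
  have e0210 := E 0 2 1 0
  have e0212 := E 0 2 1 2
  have e1201 := E 1 2 0 1
  have e1202 := E 1 2 0 2
  simp only [Fin.sum_univ_three, hs 1 0, hs 2 0, hs 2 1, t0, t1, t2]
    at e0100 e0101 e0102 e0110 e0111 e0112 e0120 e0121 e0200 e0201 e0202 e0210 e0212 e1201 e1202
  simp [-mul_eq_zero]
    at e0100 e0101 e0102 e0110 e0111 e0112 e0120 e0121 e0200 e0201 e0202 e0210 e0212 e1201 e1202
  refine pluckerRel_eq_zero _ (minorsOf_skew b) ?_ a₁ a₂ a₃ a₄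
  intro a₁ a₂ a₃ a₄ h₁ h₂ h₃
  have h4 : (a₁, a₂, a₃, a₄) ∈ ({(0, 1, 2, 3), (0, 1, 2, 4), (0, 1, 2, 5), (0, 1, 3, 4),
    (0, 1, 3, 5), (0, 1, 4, 5), (0, 2, 3, 4), (0, 2, 3, 5), (0, 2, 4, 5), (0, 3, 4, 5),
    (1, 2, 3, 4), (1, 2, 3, 5), (1, 2, 4, 5), (1, 3, 4, 5), (2, 3, 4, 5)} :
    Finset (Fin 6 × Fin 6 × Fin 6 × Fin 6)) := by
    revert a₁ a₂ a₃ a₄; decide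
  simp only [Finset.mem_insert, Finset.mem_singleton, Prod.mk.injEq] at h4
  rcases h4 with ⟨rfl, rfl, rfl, rfl⟩ | ⟨rfl, rfl, rfl, rfl⟩ | ⟨rfl, rfl, rfl, rfl⟩
    | ⟨rfl, rfl, rfl, rfl⟩ | ⟨rfl, rfl, rfl, rfl⟩ | ⟨rfl, rfl, rfl, rfl⟩
    | ⟨rfl, rfl, rfl, rfl⟩ | ⟨rfl, rfl, rfl, rfl⟩ | ⟨rfl, rfl, rfl, rfl⟩
    | ⟨rfl, rfl, rfl, rfl⟩ | ⟨rfl, rfl, rfl, rfl⟩ | ⟨rfl, rfl, rfl, rfl⟩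
    | ⟨rfl, rfl, rfl, rfl⟩ | ⟨rfl, rfl, rfl, rfl⟩ | ⟨rfl, rfl, rfl, rfl⟩ <;>
    simp only [pluckerRel, minorsOf, Matrix.cons_val]
  · linear_combination (-2) * e0102 + (2) * e0201
  · linear_combination (-2) * e0112 + (2) * e0200
  · linear_combination (-2) * e0100 + (-2) * e0111
  · linear_combination (1) * e0100 + (-1) * e0111
  · linear_combination (1) * e0121
  · linear_combination (1) * e0120
  · linear_combination (1) * e0212
  · linear_combination (1) * e0112 + (1) * e0200
  · linear_combination (-1) * e0210
  · linear_combination (-1) * e0110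
  · linear_combination (-1) * e1202
  · linear_combination (-1) * e1201
  · linear_combination (-1) * e0102 + (-1) * e0201
  · linear_combination (-1) * e0101
  · linear_combination (1) * e0202

/-! ### Chart points -/

theorem chartMatrix_inl_inl (c : ChartIndex → ℂ) (u : U) (i j : Fin 3) :
    chartMatrix c u (Sum.inl i) (Sum.inl j) = ∑ k, u k * c (Sum.inl (k, i, j)) := rfl

theorem chartMatrix_inl_inr (c : ChartIndex → ℂ) (u : U) (i : Fin 3) (x : Unit) :
    chartMatrix c u (Sum.inl i) (Sum.inr x) = u i := rfl

theorem chartMatrix_inr_inl (c : ChartIndex → ℂ) (u : U) (j : Fin 3) (x : Unit) :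
    chartMatrix c u (Sum.inr x) (Sum.inl j) = ∑ k, u k * c (Sum.inr (k, j)) := rfl

theorem chartMatrix_inr_inr (c : ChartIndex → ℂ) (u : U) (x y : Unit) :
    chartMatrix c u (Sum.inr x) (Sum.inr y) = -(chartA c u).trace := rfl

/-- The linear parametrization of a chart point. -/
def chartLin (c : ChartIndex → ℂ) : U →ₗ[ℂ] Sl I4 where
  toFun u := ⟨chartMatrix c u, chartMatrix_mem c u⟩
  map_add' u v := by
    apply Subtype.ext
    change chartMatrix c (u + v) = chartMatrix c u + chartMatrix c v
    ext (i | i) (j | j) <;>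
      simp [chartMatrix_inl_inl, chartMatrix_inl_inr, chartMatrix_inr_inl, chartMatrix_inr_inr,
        add_mul, Finset.sum_add_distrib, Matrix.trace, chartA]
    ring
  map_smul' t u := by
    apply Subtype.ext
    change chartMatrix c (t • u) = t • chartMatrix c u
    ext (i | i) (j | j) <;>
      simp [chartMatrix_inl_inl, chartMatrix_inl_inr, chartMatrix_inr_inl, chartMatrix_inr_inr,
        mul_assoc, Finset.mul_sum, Matrix.trace, chartA]

theorem chartLin_val (c : ChartIndex → ℂ) (u : U) : (chartLin c u).val = chartMatrix c u := rfl

theorem chartPoint_eq_range (c : ChartIndex → ℂ) : chartPoint c = LinearMap.range (chartLin c) := by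
  rw [chartPoint]
  exact (congrArg _ (LinearMap.coe_range (chartLin c)).symm).trans (Submodule.span_eq _)

theorem chartLin_injective (c : ChartIndex → ℂ) : Function.Injective (chartLin c) := by
  intro u v h
  ext i
  exact congrArg (fun X : Sl I4 => X.val (Sum.inl i) (Sum.inr ())) h

/-- A chart point is isomorphic to `U`. -/
def chartEquiv (c : ChartIndex → ℂ) : U ≃ₗ[ℂ] chartPoint c :=
  (LinearEquiv.ofInjective (chartLin c) (chartLin_injective c)).trans
    (LinearEquiv.ofEq _ _ (chartPoint_eq_range c).symm)

theorem chartEquiv_coe (c : ChartIndex → ℂ) (u : U) : (chartEquiv c u : Sl I4) = chartLin c u := rfl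

theorem finrank_chartPoint (c : ChartIndex → ℂ) : Module.finrank ℂ (chartPoint c) = 3 := by
  rw [← (chartEquiv c).finrank_eq]; simp

theorem mem_chartPoint {c : ChartIndex → ℂ} {X : Sl I4} :
    X ∈ chartPoint c ↔ ∃ u, chartLin c u = X := by
  rw [chartPoint_eq_range]; rfl

/-- The chart matrix of a basis vector. -/
def chartBasisMatrix (c : ChartIndex → ℂ) (i : Fin 3) : Matrix I4 I4 ℂ :=
  chartMatrix c (Pi.single i 1)

theorem chartMatrix_eq_sum (c : ChartIndex → ℂ) (u : U) :
    chartMatrix c u = ∑ i, u i • chartBasisMatrix c i := by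
  have h : chartLin c u = ∑ i, u i • chartLin c (Pi.single i 1) := by
    conv_lhs => rw [pi_eq_sum_univ' u]
    simp only [map_sum, map_smul]
  have := congrArg Subtype.val h
  rw [chartLin_val] at this
  rw [this]
  simp [chartLin_val, chartBasisMatrix]

theorem trace_eq_zero_of_mem_normalSlice {c : ChartIndex → ℂ} (hc : c ∈ normalSlice) (i : Fin 3) :
    ∑ k, c (Sum.inl (i, k, k)) = 0 := by
  have := hc (Pi.single i 1)
  simpa [Matrix.trace, chartA, Pi.single_apply] using this

theorem mem_normalSlice {c : ChartIndex → ℂ} (hc : ∀ i, ∑ k, c (Sum.inl (i, k, k)) = 0) :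
    c ∈ normalSlice := by
  intro u
  simp only [Matrix.trace, chartA, Matrix.diag_apply, Matrix.of_apply]
  rw [Finset.sum_comm]
  simp [← Finset.mul_sum, hc]

section BasisMatrix

variable (c : ChartIndex → ℂ) (i : Fin 3)

theorem chartBasisMatrix_inl_inl (k l : Fin 3) :
    chartBasisMatrix c i (Sum.inl k) (Sum.inl l) = c (Sum.inl (i, k, l)) := by
  simp [chartBasisMatrix, chartMatrix_inl_inl, Pi.single_apply]

theorem chartBasisMatrix_inl_inr (k : Fin 3) (x : Unit) :
    chartBasisMatrix c i (Sum.inl k) (Sum.inr x) = if k = i then 1 else 0 := by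
  simp [chartBasisMatrix, chartMatrix_inl_inr, Pi.single_apply]

theorem chartBasisMatrix_inr_inl (l : Fin 3) (x : Unit) :
    chartBasisMatrix c i (Sum.inr x) (Sum.inl l) = c (Sum.inr (i, l)) := by
  simp [chartBasisMatrix, chartMatrix_inr_inl, Pi.single_apply]

theorem chartBasisMatrix_inr_inr (hc : c ∈ normalSlice) (x y : Unit) :
    chartBasisMatrix c i (Sum.inr x) (Sum.inr y) = 0 := by
  simp [chartBasisMatrix, chartMatrix_inr_inr, hc (Pi.single i 1)]

end BasisMatrix

/-! ### Commuting slice points and decomposable bivectors -/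

/-- The quadratic expression of the linear form part in terms of the endomorphism part. -/
def sliceAlpha {R : Type*} [CommRing R] [Algebra ℂ R] (b : Fin 3 → Fin 3 → Fin 3 → R)
    (i j : Fin 3) : R :=
  algebraMap ℂ R (1 / 2) * ∑ y, ∑ x, b i x y * b j y x

/-- The chart coordinates of the point of the slice that corresponds to a bivector. -/
def sliceCoord (m : Fin 6 → Fin 6 → ℂ) : ChartIndex → ℂ :=
  Sum.elim (fun t => coneEntry m t.1 t.2.2 t.2.1) (fun t => sliceAlpha (coneEntry m) t.1 t.2)

/-- The commuting chart points in the normal slice correspond to decomposable bivectors. -/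
theorem exists_eq_sliceCoord {c : ChartIndex → ℂ} (hc : c ∈ normalSlice)
    (h : ∀ u v, chartMatrix c u * chartMatrix c v = chartMatrix c v * chartMatrix c u) :
    ∃ p q : Fin 6 → ℂ, c = sliceCoord (minor p q) := by
  have hb : ∀ i j, chartBasisMatrix c i * chartBasisMatrix c j =
      chartBasisMatrix c j * chartBasisMatrix c i := fun i j => h _ _
  set b : Fin 3 → Fin 3 → Fin 3 → ℂ := fun i j k => c (Sum.inl (i, k, j)) with hbdef
  set α : Fin 3 → Fin 3 → ℂ := fun i j => c (Sum.inr (i, j)) with hα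
  -- The upper right block of the commutator gives symmetry, the upper left block gives E. The two
  -- lower blocks are not needed.
  have hs : ∀ i j k, b i j k = b j i k := by
    intro i j k
    have := congrFun (congrFun (hb i j) (Sum.inl k)) (Sum.inr ())
    simpa [Matrix.mul_apply, chartBasisMatrix_inl_inl, chartBasisMatrix_inl_inr,
      chartBasisMatrix_inr_inr, hc, b] using this
  have ht : ∀ i, ∑ k, b i k k = 0 := trace_eq_zero_of_mem_normalSlice hc
  have E : ∀ i j k l, ∑ x, b i x k * b j l x - ∑ x, b j x k * b i l x =
      (if k = j then α i l else 0) - (if k = i then α j l else 0) := by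
    intro i j k l
    have := congrFun (congrFun (hb i j) (Sum.inl k)) (Sum.inl l)
    simp [Matrix.mul_apply, chartBasisMatrix_inl_inl, chartBasisMatrix_inl_inr,
      chartBasisMatrix_inr_inl] at this
    simp only [b, α]
    linear_combination this
  have hα2 : ∀ i j, α i j = (∑ y, ∑ x, b i x y * b j y x) / 2 := by
    intro i j
    rw [← two_mul_alpha b α hs ht E i j]; ring
  obtain ⟨p, q, hm⟩ := exists_eq_minor (minorsOf b)
    (pluckerRel_minorsOf b hs ht fun i j k l => by rw [← hα2, ← hα2]; exact E i j k l)
  have hcone : coneEntry (minor p q) = b := by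
    rw [← hm]
    ext i j k
    exact coneEntry_minorsOf b hs ht i j k
  refine ⟨p, q, ?_⟩
  ext (⟨i, k, j⟩ | ⟨i, j⟩)
  · change _ = coneEntry (minor p q) i j k
    rw [hcone]
  · change _ = sliceAlpha (coneEntry (minor p q)) i j
    rw [hcone]
    change α i j = _
    rw [hα2, sliceAlpha]
    simp; ring

theorem sliceAlpha_comm (b : Fin 3 → Fin 3 → Fin 3 → ℂ) (i j : Fin 3) :
    sliceAlpha b i j = sliceAlpha b j i := by
  unfold sliceAlpha
  rw [Finset.sum_comm]
  simp only [mul_comm]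

theorem sliceCoord_mem_normalSlice (m : Fin 6 → Fin 6 → ℂ) (hm : ∀ a b, m a b = -m b a) :
    sliceCoord m ∈ normalSlice :=
  mem_normalSlice (coneEntry_trace m hm)

set_option maxHeartbeats 1000000 in
-- The converse computation: for a decomposable bivector the upper left block of the commutator
-- vanishes identically in p and q. Both sides are exchanged by swapping i and j, so three pairs
-- suffice.
theorem coneEntry_minor_bracket (p q : Fin 6 → ℂ) (i j k l : Fin 3) :
    ∑ x, coneEntry (minor p q) i x k * coneEntry (minor p q) j l x
        + (if k = i then sliceAlpha (coneEntry (minor p q)) j l else 0) =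
      ∑ x, coneEntry (minor p q) j x k * coneEntry (minor p q) i l x
        + (if k = j then sliceAlpha (coneEntry (minor p q)) i l else 0) := by
  wlog hij : i < j generalizing i j
  · rcases eq_or_lt_of_le (not_lt.mp hij) with rfl | h
    · rfl
    · exact (this j i h).symm
  have hc : (i, j) ∈ ({(0, 1), (0, 2), (1, 2)} : Finset (Fin 3 × Fin 3)) := by
    revert i j; decide
  simp only [Finset.mem_insert, Finset.mem_singleton, Prod.mk.injEq] at hc
  rcases hc with ⟨rfl, rfl⟩ | ⟨rfl, rfl⟩ | ⟨rfl, rfl⟩ <;> fin_cases k <;> fin_cases l <;>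
  · simp [Fin.sum_univ_three, sliceAlpha, coneEntry, symIdx, minor]
    ring

theorem sliceCoord_inl (m : Fin 6 → Fin 6 → ℂ) (i k j : Fin 3) :
    sliceCoord m (Sum.inl (i, k, j)) = coneEntry m i j k := rfl

theorem sliceCoord_inr (m : Fin 6 → Fin 6 → ℂ) (i j : Fin 3) :
    sliceCoord m (Sum.inr (i, j)) = sliceAlpha (coneEntry m) i j := rfl

/-- The commutator of two basis matrices of a slice point is concentrated in the last row. -/
theorem commutator_sliceCoord (p q : Fin 6 → ℂ) (i j : Fin 3) (x : I4) (y : I4)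
    (hxy : ∀ l : Fin 3, ¬(x = Sum.inr () ∧ y = Sum.inl l)) :
    (chartBasisMatrix (sliceCoord (minor p q)) i * chartBasisMatrix (sliceCoord (minor p q)) j
      - chartBasisMatrix (sliceCoord (minor p q)) j
        * chartBasisMatrix (sliceCoord (minor p q)) i) x y = 0 := by
  have hN := sliceCoord_mem_normalSlice (minor p q) (minor_skew p q)
  rw [Matrix.sub_apply, sub_eq_zero]
  rcases x with k | ⟨⟩ <;> rcases y with l | ⟨⟩
  · have := coneEntry_minor_bracket p q i j k l
    simpa [Matrix.mul_apply, chartBasisMatrix_inl_inl, chartBasisMatrix_inl_inr,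
      chartBasisMatrix_inr_inl, sliceCoord_inl, sliceCoord_inr] using this
  · simp [Matrix.mul_apply, chartBasisMatrix_inl_inl, chartBasisMatrix_inl_inr,
      chartBasisMatrix_inr_inr, sliceCoord_inl, hN, coneEntry_comm _ i j]
  · exact absurd ⟨rfl, rfl⟩ (hxy l)
  · simp [Matrix.mul_apply, chartBasisMatrix_inr_inl, chartBasisMatrix_inl_inr,
      chartBasisMatrix_inr_inr, sliceCoord_inr, hN, sliceAlpha_comm _ i j]

/-- The remaining block, of degree three in A, needs no expansion: the Jacobi identity kills it. A
commutator C concentrated in the last row satisfies [C, M d](w, l) = −C(last, l) if d = w and 0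
otherwise. With w different from i and j, only one term of the Jacobi identity for i, j, w survives.
-/
theorem chartBasisMatrix_sliceCoord_commute (p q : Fin 6 → ℂ) (i j : Fin 3) :
    Commute (chartBasisMatrix (sliceCoord (minor p q)) i)
      (chartBasisMatrix (sliceCoord (minor p q)) j) := by
  by_cases hij : i = j
  · subst hij; exact Commute.refl _
  obtain ⟨w, hwi, hwj⟩ : ∃ w, w ≠ i ∧ w ≠ j := by
    revert i j; decide
  set M := chartBasisMatrix (sliceCoord (minor p q)) with hM
  rw [commute_iff_eq, ← sub_eq_zero]
  ext x y
  by_cases hxy : ∀ l : Fin 3, ¬(x = Sum.inr () ∧ y = Sum.inl l)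
  · exact commutator_sliceCoord p q i j x y hxy
  push Not at hxy
  obtain ⟨l, rfl, rfl⟩ := hxy
  have K0 : ∀ i j (k : Fin 3) (y : I4), (M i * M j - M j * M i) (Sum.inl k) y = 0 := fun i j k y =>
    commutator_sliceCoord p q i j _ y (by simp)
  have key : ∀ a b d : Fin 3, ((M a * M b - M b * M a) * M d - M d * (M a * M b - M b * M a))
      (Sum.inl w) (Sum.inl l) =
      if w = d then -(M a * M b - M b * M a) (Sum.inr ()) (Sum.inl l) else 0 := by
    intro a b d
    rw [Matrix.sub_apply, Matrix.mul_apply (M := M a * M b - M b * M a),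
      Matrix.mul_apply (N := M a * M b - M b * M a)]
    simp only [K0, zero_mul, Finset.sum_const_zero, Fintype.sum_sum_type, mul_zero]
    simp only [Finset.univ_unique, Finset.sum_singleton, zero_add, zero_sub]
    rw [hM, chartBasisMatrix_inl_inr, ← hM]
    split_ifs <;> simp
  have jac : ((M i * M j - M j * M i) * M w - M w * (M i * M j - M j * M i))
      + ((M j * M w - M w * M j) * M i - M i * (M j * M w - M w * M j))
      + ((M w * M i - M i * M w) * M j - M j * (M w * M i - M i * M w)) = 0 := by
    noncomm_ring
  have := congrFun (congrFun jac (Sum.inl w)) (Sum.inl l)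
  rw [Matrix.add_apply, Matrix.add_apply, key, key, key, if_pos rfl, if_neg hwi, if_neg hwj] at this
  rw [Matrix.zero_apply, add_zero, add_zero, neg_eq_zero] at this
  exact this

theorem chartMatrix_sliceCoord_commute (p q : Fin 6 → ℂ) (u v : U) :
    Commute (chartMatrix (sliceCoord (minor p q)) u) (chartMatrix (sliceCoord (minor p q)) v) := by
  rw [chartMatrix_eq_sum, chartMatrix_eq_sum _ v]
  refine Commute.sum_left _ _ _ fun i _ => Commute.sum_right _ _ _ fun j _ => ?_
  exact ((chartBasisMatrix_sliceCoord_commute p q i j).smul_left _).smul_right _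

/-! ### The trace form, the centralizer and the Cartan property -/

/-- The blocks contribute tr A(u)A(v) = 2α(u)(v) and α(u)(v) + α(v)(u), so the determinant of α
decides whether the trace form is nondegenerate on the chart point. -/
theorem trace_chartBasisMatrix_mul (m : Fin 6 → Fin 6 → ℂ) (hm : ∀ a b, m a b = -m b a)
    (i j : Fin 3) :
    (chartBasisMatrix (sliceCoord m) i * chartBasisMatrix (sliceCoord m) j).trace
      = 4 * sliceAlpha (coneEntry m) i j := by
  have hN := sliceCoord_mem_normalSlice m hm
  have h : ∑ k, ∑ x, coneEntry m i x k * coneEntry m j k x = 2 * sliceAlpha (coneEntry m) i j := by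
    simp [sliceAlpha]
  simp [Matrix.trace, Matrix.mul_apply, chartBasisMatrix_inl_inl, chartBasisMatrix_inl_inr,
    chartBasisMatrix_inr_inl, chartBasisMatrix_inr_inr, hN, sliceCoord_inl, sliceCoord_inr,
    Finset.sum_add_distrib, h]
  rw [sliceAlpha_comm _ j i]; ring

/-- A matrix that commutes with all the matrices of a chart point in the normal slice is, up to a
scalar, one of them. -/
theorem eq_chartMatrix_add_scalar {c : ChartIndex → ℂ} (hc : c ∈ normalSlice)
    (hcomm : ∀ u v, Commute (chartMatrix c u) (chartMatrix c v)) (Y : Matrix I4 I4 ℂ)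
    (hY : ∀ u, Commute Y (chartMatrix c u)) :
    Y = chartMatrix c (fun i => Y (Sum.inl i) (Sum.inr ()))
      + Y (Sum.inr ()) (Sum.inr ()) • (1 : Matrix I4 I4 ℂ) := by
  set u : U := fun i => Y (Sum.inl i) (Sum.inr ())
  set t := Y (Sum.inr ()) (Sum.inr ())
  -- The last basis vector is cyclic: together with its images under the chart matrices it spans the
  -- whole space. After subtraction Y multiplies it by t, and commutation then makes Y the scalar t
  -- everywhere.
  have hZ : ∀ v, Commute (Y - chartMatrix c u) (chartMatrix c v) := fun v =>
    (hY v).sub_left (hcomm u v)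
  have hcol : ∀ x, (Y - chartMatrix c u) x (Sum.inr ()) = if x = Sum.inr () then t else 0 := by
    rintro (k | ⟨⟩)
    · simp [u, chartMatrix_inl_inr]
    · simp [t, chartMatrix_inr_inr, hc u]
  rw [← sub_eq_iff_eq_add']
  ext x (j | ⟨⟩)
  · have h := congrFun (congrFun (hZ (Pi.single j 1)) x) (Sum.inr ())
    simp only [Matrix.mul_apply, hcol] at h
    simp [Fintype.sum_sum_type, chartMatrix_inl_inr, chartMatrix_inr_inr, hc (Pi.single j 1),
      Pi.single_apply] at h
    rw [Matrix.sub_apply, h]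
    rcases x with k | ⟨⟩
    · simp [chartMatrix_inl_inr, Pi.single_apply, Matrix.one_apply]
    · simp [chartMatrix_inr_inr, hc (Pi.single j 1)]
  · rw [hcol]
    simp [Matrix.one_apply]

theorem sl_lie_eq_zero {X Y : Sl I4} : ⁅X, Y⁆ = 0 ↔ Commute X.val Y.val := by
  rw [commute_iff_eq, Subtype.ext_iff, LieAlgebra.SpecialLinear.sl_bracket]
  exact sub_eq_zero

theorem trace_val (X : Sl I4) : X.val.trace = 0 := by
  simpa [LieAlgebra.SpecialLinear.sl] using X.2

/-- A commuting chart point in the normal slice on which the trace form is nondegenerate is a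
Cartan subalgebra. -/
theorem chartPoint_mem_redOpen (p q : Fin 6 → ℂ)
    (hD : (Matrix.of (sliceAlpha (coneEntry (minor p q)))).det ≠ 0) :
    chartPoint (sliceCoord (minor p q)) ∈ redOpen I4 := by
  set c := sliceCoord (minor p q) with hcdef
  have hN : c ∈ normalSlice := sliceCoord_mem_normalSlice _ (minor_skew p q)
  have hcomm : ∀ u v, Commute (chartMatrix c u) (chartMatrix c v) :=
    chartMatrix_sliceCoord_commute p q
  have hbr : ∀ u v, ⁅chartLin c u, chartLin c v⁆ = 0 := fun u v => sl_lie_eq_zero.mpr (hcomm u v)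
  let H : LieSubalgebra ℂ (Sl I4) :=
    { chartPoint c with
      lie_mem' := by
        intro X Y hX hY
        obtain ⟨u, rfl⟩ := mem_chartPoint.mp hX
        obtain ⟨v, rfl⟩ := mem_chartPoint.mp hY
        rw [hbr]
        exact (chartPoint c).zero_mem }
  have hH : ∀ X, X ∈ H ↔ ∃ u, chartLin c u = X := fun X => mem_chartPoint
  refine ⟨by rw [finrank_chartPoint]; rfl, H, ⟨?_, ?_⟩, rfl⟩
  · have : IsLieAbelian H := ⟨fun X Y => by
      obtain ⟨u, hu⟩ := (hH _).mp X.2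
      obtain ⟨v, hv⟩ := (hH _).mp Y.2
      apply Subtype.ext
      change ⁅(X : Sl I4), (Y : Sl I4)⁆ = 0
      rw [← hu, ← hv, hbr]⟩
    infer_instance
  · refine le_antisymm ?_ (LieSubalgebra.le_normalizer H)
    intro y hy
    rw [LieSubalgebra.mem_normalizer_iff] at hy
    have hyc : ∀ v, Commute y.val (chartMatrix c v) := by
      intro v
      obtain ⟨w, hw⟩ := (hH _).mp (hy _ ((hH _).mpr ⟨v, rfl⟩))
      have hw' : chartMatrix c w = y.val * chartMatrix c v - chartMatrix c v * y.val := by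
        have := congrArg Subtype.val hw
        rwa [LieAlgebra.SpecialLinear.sl_bracket] at this
      -- Invariance of the trace: tr([y, M(v)] M_j) = tr(y [M(v), M_j]) = 0. A normalizing element
      -- therefore brackets the space into the radical of its trace form, which is zero, and so
      -- centralizes it.
      have htr : ∀ j, (chartMatrix c w * chartBasisMatrix c j).trace = 0 := by
        intro j
        have h1 : (chartMatrix c v * y.val * chartBasisMatrix c j).trace
            = (y.val * chartMatrix c v * chartBasisMatrix c j).trace := by
          have h2 : chartMatrix c v * chartBasisMatrix c j = chartBasisMatrix c j * chartMatrix c v :=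
            (hcomm v (Pi.single j 1)).eq
          rw [Matrix.mul_assoc, Matrix.trace_mul_comm, Matrix.mul_assoc, Matrix.mul_assoc, h2]
        rw [hw', sub_mul, Matrix.trace_sub, h1, sub_self]
      have hw0 : w = 0 := by
        refine Matrix.eq_zero_of_vecMul_eq_zero hD ?_
        ext j
        have := htr j
        rw [chartMatrix_eq_sum, Finset.sum_mul, Matrix.trace_sum] at this
        simp only [smul_mul_assoc, Matrix.trace_smul, smul_eq_mul, hcdef,
          trace_chartBasisMatrix_mul _ (minor_skew p q)] at this
        simp only [mul_left_comm _ (4 : ℂ), ← Finset.mul_sum] at this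
        simpa [Matrix.vecMul, dotProduct] using this
      rw [commute_iff_eq, ← sub_eq_zero, ← hw', hw0]
      exact congrArg Subtype.val (map_zero (chartLin c))
    have hy2 := eq_chartMatrix_add_scalar hN hcomm y.val hyc
    refine (hH y).mpr ⟨fun i => y.val (Sum.inl i) (Sum.inr ()), Subtype.ext ?_⟩
    rw [chartLin_val]
    have htr := congrArg Matrix.trace hy2
    have h0 := trace_val y
    have h1 : (chartMatrix c fun i => y.val (Sum.inl i) (Sum.inr ())).trace = 0 :=
      trace_val (chartLin c _)
    rw [Matrix.trace_add, h1, h0, Matrix.trace_smul, Matrix.trace_one] at htr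
    have ht : y.val (Sum.inr ()) (Sum.inr ()) = 0 := by simpa using htr
    rw [ht, zero_smul, add_zero] at hy2
    exact hy2.symm

/-! ### Points of the variety of reductions are commutative -/

/-- The alternating trilinear form `f [x, y] g(z) + f [y, z] g(x) + f [z, x] g(y)`. -/
def bracketForm {L : Type*} [LieRing L] [LieAlgebra ℂ L] (f g : Module.Dual ℂ L) :
    L [⋀^Fin 3]→ₗ[ℂ] ℂ where
  toFun v := f ⁅v 0, v 1⁆ * g (v 2) + f ⁅v 1, v 2⁆ * g (v 0) + f ⁅v 2, v 0⁆ * g (v 1)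
  map_update_add' v i x y := by
    rename_i inst
    obtain rfl := Subsingleton.elim inst (instDecidableEqFin 3)
    fin_cases i <;> simp <;> ring
  map_update_smul' v i t x := by
    rename_i inst
    obtain rfl := Subsingleton.elim inst (instDecidableEqFin 3)
    fin_cases i <;> simp <;> ring
  map_eq_zero_of_eq' v i j h hij := by
    have key : ∀ i j, i < j → v i = v j →
        f ⁅v 0, v 1⁆ * g (v 2) + f ⁅v 1, v 2⁆ * g (v 0) + f ⁅v 2, v 0⁆ * g (v 1) = 0 := by
      intro i j hij h
      fin_cases i <;> fin_cases j <;> first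
        | exact absurd hij (by decide)
        | (simp at h
           rw [h]
           simp only [lie_self, map_zero]
           first
             | (rw [← lie_skew (v 2) (v 1), map_neg]; ring)
             | (rw [← lie_skew (v 2) (v 0), map_neg]; ring))
    rcases lt_or_gt_of_ne hij with hij | hij
    · exact key i j hij h
    · exact key j i hij h.symm

theorem bracketForm_apply {L : Type*} [LieRing L] [LieAlgebra ℂ L] (f g : Module.Dual ℂ L)
    (v : Fin 3 → L) : bracketForm f g v =
      f ⁅v 0, v 1⁆ * g (v 2) + f ⁅v 1, v 2⁆ * g (v 0) + f ⁅v 2, v 0⁆ * g (v 1) := rfl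

/-- If a set of subspaces of dimension three of a Lie algebra consists of commutative subspaces,
so does its Zariski closure. -/
theorem lie_eq_zero_of_mem_closure {L : Type*} [LieRing L] [LieAlgebra ℂ L]
    {S : Set (Submodule ℂ L)} (hS : ∀ K ∈ S, ∀ X ∈ K, ∀ Y ∈ K, ⁅X, Y⁆ = 0)
    {K : Submodule ℂ L} (hK : K ∈ grassmannianClosure 3 S) {X Y : L} (hX : X ∈ K) (hY : Y ∈ K) :
    ⁅X, Y⁆ = 0 := by
  obtain ⟨hdim, hK⟩ := hK
  have : Module.Finite ℂ K := Module.finite_of_finrank_pos (by omega)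
  let b := Module.finBasisOfFinrankEq ℂ K hdim
  -- The alternating form `bracketForm f g` is a linear form in the Plücker coordinates, that is, a
  -- homogeneous polynomial of degree 1, and it vanishes on commutative subspaces.
  have hform : ∀ f g : Module.Dual ℂ L, bracketForm f g (fun i => (b i : L)) = 0 := by
    intro f g
    have h := hK 1 (MvPolynomial.X (exteriorPower.alternatingMapLinearEquiv (bracketForm f g)))
      (MvPolynomial.isHomogeneous_X _ _) ?_ b
    · simpa [pluckerVector] using h
    · intro K' hK' b'
      have hb : ∀ i j, ⁅(b' i : L), (b' j : L)⁆ = 0 := fun i j =>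
        hS K' hK' _ (b' i).2 _ (b' j).2
      simp [pluckerVector, bracketForm_apply, hb]
  have hdual : ∀ i, ∃ g : Module.Dual ℂ L, ∀ j, g (b j) = if i = j then 1 else 0 := by
    intro i
    obtain ⟨g, hg⟩ := LinearMap.exists_extend (b.coord i)
    refine ⟨g, fun j => ?_⟩
    have := LinearMap.congr_fun hg (b j)
    simpa [Finsupp.single_apply, eq_comm] using this
  have hzero : ∀ x : L, (∀ f : Module.Dual ℂ L, f x = 0) → x = 0 := fun x hx =>
    (Module.forall_dual_apply_eq_zero_iff ℂ x).mp hx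
  -- Taking g dual to the third basis vector isolates the value of f on the bracket of the other
  -- two.
  have h01 : ⁅(b 0 : L), (b 1 : L)⁆ = 0 := by
    obtain ⟨g, hg⟩ := hdual 2
    exact hzero _ fun f => by simpa [bracketForm_apply, hg] using hform f g
  have h12 : ⁅(b 1 : L), (b 2 : L)⁆ = 0 := by
    obtain ⟨g, hg⟩ := hdual 0
    exact hzero _ fun f => by simpa [bracketForm_apply, hg] using hform f g
  have h20 : ⁅(b 2 : L), (b 0 : L)⁆ = 0 := by
    obtain ⟨g, hg⟩ := hdual 1
    exact hzero _ fun f => by simpa [bracketForm_apply, hg] using hform f g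
  have hb : ∀ i j, ⁅(b i : L), (b j : L)⁆ = 0 := by
    intro i j
    fin_cases i <;> fin_cases j <;> first
      | exact lie_self _
      | assumption
      | (rw [← lie_skew, neg_eq_zero]; assumption)
  have hsum : ∀ Z : K, (Z : L) = ∑ i, b.repr Z i • (b i : L) := fun Z => by
    calc (Z : L) = K.subtype (∑ i, b.repr Z i • b i) := by rw [b.sum_repr]; rfl
      _ = _ := by rw [map_sum]; rfl
  have hX' := hsum ⟨X, hX⟩
  have hY' := hsum ⟨Y, hY⟩
  simp only at hX' hY'
  rw [hX', hY']
  simp [sum_lie, lie_sum, hb]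

/-! ### Cartan subalgebras of sl_4 are commutative -/

/-- Off-diagonal elementary matrices move a nonzero coordinate of any vector to any other position,
so a nonzero submodule contains all basis vectors. -/
instance isIrreducible_sl : LieModule.IsIrreducible ℂ (Sl I4) (I4 → ℂ) := by
  refine LieModule.IsIrreducible.mk fun N hN => ?_
  obtain ⟨v, hv, hv0⟩ := (Submodule.ne_bot_iff N.toSubmodule).mp
    fun h => hN ((LieSubmodule.toSubmodule_eq_bot N).mp h)
  obtain ⟨j, hj⟩ : ∃ j, v j ≠ 0 := by
    by_contra! h
    exact hv0 (funext h)
  have hact : ∀ i k (hik : i ≠ k) w, w ∈ N → w k ≠ 0 → Pi.single i (1 : ℂ) ∈ N := by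
    intro i k hik w hw hwk
    have h1 := N.lie_mem (x := LieAlgebra.SpecialLinear.single i k hik (1 : ℂ)) hw
    have h2 : ⁅LieAlgebra.SpecialLinear.single i k hik (1 : ℂ), w⁆ = w k • Pi.single i (1 : ℂ) := by
      change Matrix.single i k (1 : ℂ) *ᵥ w = _
      rw [Matrix.single_mulVec]
      ext x
      by_cases hx : x = i
      · subst hx; simp
      · simp [hx]
    rw [h2] at h1
    have := N.smul_mem (w k)⁻¹ h1
    rwa [smul_smul, inv_mul_cancel₀ hwk, one_smul] at this
  have hoff : ∀ i, i ≠ j → Pi.single i (1 : ℂ) ∈ N := fun i hi => hact i j hi v hv hj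
  have hall : ∀ i, Pi.single i (1 : ℂ) ∈ N := by
    intro i
    by_cases hi : i = j
    · subst hi
      obtain ⟨k, hk⟩ : ∃ k, k ≠ i := by
        rcases i with i | i
        · exact ⟨Sum.inr (), by simp⟩
        · exact ⟨Sum.inl 0, by simp⟩
      exact hact i k hk.symm _ (hoff k hk) (by simp)
    · exact hoff i hi
  rw [eq_top_iff]
  intro w _
  rw [pi_eq_sum_univ' w]
  exact sum_mem fun i _ => N.smul_mem _ (hall i)

instance isFaithful_sl : LieModule.IsFaithful ℂ (Sl I4) (I4 → ℂ) where
  injective_toEnd X Y h := by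
    apply Subtype.ext
    apply Matrix.toLin'.injective
    exact h

/-- The criterion requires a faithful irreducible representation by endomorphisms of trace zero.
Semisimplicity is wanted because it upgrades nilpotent Cartan subalgebras to commutative ones. -/
theorem hasTrivialRadical_sl : LieAlgebra.HasTrivialRadical ℂ (Sl I4) := by
  refine LieAlgebra.hasTrivialRadical_of_isIrreducible_of_isFaithful ℂ (Sl I4) (I4 → ℂ) fun X => ?_
  have h : LieModule.toEnd ℂ (Sl I4) (I4 → ℂ) X = Matrix.toLin' X.val := rfl
  rw [h, Matrix.trace_toLin'_eq, trace_val]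

theorem lie_eq_zero_of_mem_redOpen {K : Submodule ℂ (Sl I4)} (hK : K ∈ redOpen I4)
    {X Y : Sl I4} (hX : X ∈ K) (hY : Y ∈ K) : ⁅X, Y⁆ = 0 := by
  obtain ⟨-, H, hH, rfl⟩ := hK
  have := hasTrivialRadical_sl
  have h : IsLieAbelian H := inferInstance
  have := h.trivial ⟨X, hX⟩ ⟨Y, hY⟩
  exact congrArg Subtype.val this

theorem lie_eq_zero_of_mem_red {K : Submodule ℂ (Sl I4)} (hK : K ∈ red I4)
    {X Y : Sl I4} (hX : X ∈ K) (hY : Y ∈ K) : ⁅X, Y⁆ = 0 :=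
  lie_eq_zero_of_mem_closure (S := redOpen I4)
    (fun _ hK _ hX _ hY => lie_eq_zero_of_mem_redOpen hK hX hY) hK hX hY

/-! ### Invariance under automorphisms -/

theorem map_mem_redOpen (φ : Sl I4 ≃ₗ⁅ℂ⁆ Sl I4) {K : Submodule ℂ (Sl I4)} (hK : K ∈ redOpen I4) :
    K.map (φ : Sl I4 →ₗ[ℂ] Sl I4) ∈ redOpen I4 := by
  obtain ⟨hdim, H, hH, rfl⟩ := hK
  refine ⟨?_, H.map φ.toLieHom, ⟨?_, ?_⟩, rfl⟩
  · rw [← hdim]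
    exact LinearEquiv.finrank_map_eq φ.toLinearEquiv _
  · have := hH.nilpotent
    exact (LieEquiv.nilpotent_iff_equiv_nilpotent (R := ℂ)
      (LieEquiv.lieSubalgebraMap H φ)).mp this
  · refine le_antisymm ?_ (LieSubalgebra.le_normalizer _)
    intro y hy
    rw [LieSubalgebra.mem_normalizer_iff] at hy
    refine ⟨φ.symm y, ?_, φ.apply_symm_apply y⟩
    have : φ.symm y ∈ H.normalizer := by
      rw [LieSubalgebra.mem_normalizer_iff]
      intro x hx
      obtain ⟨z, hz, hzy⟩ := hy (φ x) ⟨x, hx, rfl⟩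
      have : ⁅φ.symm y, x⁆ = z := by
        apply φ.injective
        change φ ⁅φ.symm y, x⁆ = φ z
        rw [LieEquiv.map_lie, φ.apply_symm_apply]
        exact hzy.symm
      rw [this]; exact hz
    rwa [hH.self_normalizing] at this

/-- Composing the variables, which are linear forms on the exterior power, with the map induced by φ
pulls a polynomial back without changing its degree. -/
theorem map_mem_closure {V : Type*} [AddCommGroup V] [Module ℂ V] {r : ℕ} (φ : V ≃ₗ[ℂ] V)
    {S : Set (Submodule ℂ V)} (hS : ∀ K ∈ S, K.map (φ : V →ₗ[ℂ] V) ∈ S) {K : Submodule ℂ V}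
    (hK : K ∈ grassmannianClosure r S) : K.map (φ : V →ₗ[ℂ] V) ∈ grassmannianClosure r S := by
  have hpl : ∀ (K : Submodule ℂ V) (b : Module.Basis (Fin r) ℂ K),
      pluckerVector (b.map (φ.submoduleMap K)) =
        exteriorPower.map r (φ : V →ₗ[ℂ] V) (pluckerVector b) := by
    intro K b
    rw [pluckerVector, pluckerVector, exteriorPower.map_apply_ιMulti]
    rfl
  refine ⟨by rw [LinearEquiv.finrank_map_eq φ, hK.1], fun d F hF hFS b => ?_⟩
  have h := hK.2 d (MvPolynomial.rename
      (fun l : Module.Dual ℂ (⋀[ℂ]^r V) => l ∘ₗ exteriorPower.map r (φ : V →ₗ[ℂ] V)) F)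
    (hF.rename_isHomogeneous) ?_ (b.map (φ.submoduleMap K).symm)
  · rw [MvPolynomial.eval_rename] at h
    convert h using 3
    funext l
    have := hpl K (b.map (φ.submoduleMap K).symm)
    rw [Function.comp_apply, LinearMap.comp_apply, ← this]
    congr 2
    ext i
    simp
  · intro K' hK' b'
    rw [MvPolynomial.eval_rename]
    have := hFS _ (hS K' hK') (b'.map (φ.submoduleMap K'))
    convert this using 3
    funext l
    rw [Function.comp_apply, LinearMap.comp_apply]
    rw [hpl]

theorem map_mem_red (φ : Sl I4 ≃ₗ⁅ℂ⁆ Sl I4) {K : Submodule ℂ (Sl I4)} (hK : K ∈ red I4) :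
    K.map (φ : Sl I4 →ₗ[ℂ] Sl I4) ∈ red I4 :=
  map_mem_closure φ.toLinearEquiv (fun _ hK => map_mem_redOpen φ hK) hK

theorem map_mem_red_iff (φ : Sl I4 ≃ₗ⁅ℂ⁆ Sl I4) {K : Submodule ℂ (Sl I4)} :
    K.map (φ : Sl I4 →ₗ[ℂ] Sl I4) ∈ red I4 ↔ K ∈ red I4 := by
  refine ⟨fun h => ?_, map_mem_red φ⟩
  have := map_mem_red φ.symm h
  rw [← Submodule.map_comp] at this
  convert this
  conv_lhs => rw [← Submodule.map_id K]
  congr 1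
  ext x
  simp

/-! ### Slice points are limits of Cartan subalgebras -/

/-- Expansion in a basis reduces continuity to the coordinates of the arguments, so no topology on
the exterior power is ever needed. -/
theorem continuous_multilinear_comp {V X : Type*} [AddCommGroup V] [Module ℂ V]
    [TopologicalSpace X] {ι κ : Type*} [Finite ι]
    [Fintype κ] (f : MultilinearMap ℂ (fun _ : κ => V) ℂ) (B : Module.Basis ι ℂ V)
    (g : κ → X → V) (hg : ∀ k i, Continuous fun x => B.repr (g k x) i) :
    Continuous fun x => f fun k => g k x := by
  classical
  have := Fintype.ofFinite ι
  have h : ∀ x, f (fun k => g k x) =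
      ∑ r : κ → ι, (∏ k, B.repr (g k x) (r k)) * f fun k => B (r k) := by
    intro x
    conv_lhs => rw [show (fun k => g k x) = fun k => ∑ i, B.repr (g k x) i • B i from
      funext fun k => (B.sum_repr _).symm]
    rw [MultilinearMap.map_sum]
    refine Finset.sum_congr rfl fun r _ => ?_
    rw [MultilinearMap.map_smul_univ, smul_eq_mul]
  simp only [h]
  exact continuous_finsetSum _ fun r _ =>
    (continuous_finsetProd _ fun k _ => hg k (r k)).mul continuous_const

/-- The inclusion of the traceless matrices in the space of all matrices. -/
def slVal : Sl I4 →ₗ[ℂ] Matrix I4 I4 ℂ where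
  toFun X := X.val
  map_add' _ _ := rfl
  map_smul' _ _ := rfl

/-- Chart points that depend continuously on a parameter have polynomial invariants that depend
continuously on it. -/
theorem continuous_chartLin_eval {X : Type*} [TopologicalSpace X] {c : X → ChartIndex → ℂ}
    (hc : Continuous c) (F : MvPolynomial (Module.Dual ℂ (⋀[ℂ]^3 (Sl I4))) ℂ) (w : Fin 3 → U) :
    Continuous fun x => MvPolynomial.eval
      (fun l => l (exteriorPower.ιMulti ℂ 3 fun i => chartLin (c x) (w i))) F := by
  have hent : ∀ k a b, Continuous fun x => chartMatrix (c x) (w k) a b := by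
    intro k a b
    rcases a with a | a <;> rcases b with b | b
    all_goals
      simp only [chartMatrix_inl_inl, chartMatrix_inl_inr, chartMatrix_inr_inl,
        chartMatrix_inr_inr, Matrix.trace, chartA, Matrix.diag_apply, Matrix.of_apply]
      fun_prop
  obtain ⟨π, hπ⟩ := LinearMap.exists_leftInverse_of_injective slVal
    (LinearMap.ker_eq_bot.mpr Subtype.val_injective)
  have hl : ∀ l : Module.Dual ℂ (⋀[ℂ]^3 (Sl I4)), Continuous fun x =>
      l (exteriorPower.ιMulti ℂ 3 fun i => chartLin (c x) (w i)) := by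
    intro l
    have h := continuous_multilinear_comp
      ((l.compMultilinearMap (exteriorPower.ιMulti ℂ 3 (M := Sl I4)).toMultilinearMap).compLinearMap
        fun _ => π) (Matrix.stdBasis ℂ I4 I4) (fun k x => chartMatrix (c x) (w k)) (by
          rintro k ⟨a, b⟩
          have hM : Continuous fun x => chartMatrix (c x) (w k) := continuous_matrix (hent k)
          exact (LinearMap.continuous_of_finiteDimensional
            ((Matrix.stdBasis ℂ I4 I4).coord (a, b))).comp hM)
    refine h.congr fun x => ?_
    have hx : ∀ k, π (chartMatrix (c x) (w k)) = chartLin (c x) (w k) := fun k =>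
      LinearMap.congr_fun hπ (chartLin (c x) (w k))
    simp [hx]
  have : Continuous fun x => (fun l : Module.Dual ℂ (⋀[ℂ]^3 (Sl I4)) =>
      l (exteriorPower.ιMulti ℂ 3 fun i => chartLin (c x) (w i))) := continuous_pi hl
  exact (MvPolynomial.continuous_eval F).comp this

/-- A family of chart points on a line that is generically in the open part lies in the closure. -/
theorem chartPoint_mem_red_of_line {c : ℂ → ChartIndex → ℂ} (hc : Continuous c) {D : ℂ → ℂ}
    (hD : Differentiable ℂ D) (hD0 : D 0 ≠ 0) (h : ∀ s, D s ≠ 0 → chartPoint (c s) ∈ redOpen I4)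
    (s : ℂ) : chartPoint (c s) ∈ red I4 := by
  refine ⟨by rw [finrank_chartPoint]; rfl, fun d F hF hFS b => ?_⟩
  change Module.Basis (Fin 3) ℂ _ at b
  -- The basis of the chart point at s is carried to the other parameters by keeping its coordinates
  -- in U fixed, so that F becomes a continuous function of the parameter alone.
  set w : Fin 3 → U := fun i => (chartEquiv (c s)).symm (b i) with hw
  set f : ℂ → ℂ := fun t => MvPolynomial.eval
    (fun l => l (exteriorPower.ιMulti ℂ 3 fun i => chartLin (c t) (w i))) F with hf
  have hfc : Continuous f := continuous_chartLin_eval hc F w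
  have hf0 : ∀ t, D t ≠ 0 → f t = 0 := by
    intro t ht
    exact hFS _ (h t ht) (b.map ((chartEquiv (c s)).symm.trans (chartEquiv (c t))))
  have hfs : f s = 0 := by
    -- By the identity theorem the zeros of D are isolated, so f vanishes on a punctured
    -- neighbourhood of s, whether or not D s is zero.
    have hev : ∀ᶠ t in nhdsWithin s {s}ᶜ, D t ≠ 0 := by
      by_contra hcon
      have := AnalyticOnNhd.eqOn_zero_of_preconnected_of_frequently_eq_zero (U := Set.univ)
        (fun t _ => hD.analyticAt t) isPreconnected_univ (Set.mem_univ s)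
        (by simpa [Filter.not_eventually] using hcon)
      exact hD0 (this (Set.mem_univ 0))
    have hev2 : ∀ᶠ t in nhdsWithin s {s}ᶜ, f t = 0 := hev.mono hf0
    have h1 : Filter.Tendsto f (nhdsWithin s {s}ᶜ) (nhds (f s)) :=
      (hfc.tendsto s).mono_left nhdsWithin_le_nhds
    exact tendsto_nhds_unique h1 (tendsto_const_nhds.congr' (hev2.mono fun t ht => ht.symm))
  have hb : ∀ i, (b i : Sl I4) = chartLin (c s) (w i) := by
    intro i
    rw [← chartEquiv_coe, hw, LinearEquiv.apply_symm_apply]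
  rw [hf] at hfs
  simp only [← hb] at hfs
  exact hfs

theorem chartPoint_sliceCoord_mem_red (p q : Fin 6 → ℂ) :
    chartPoint (sliceCoord (minor p q)) ∈ red I4 := by
  -- The pencil of conics x² − y², 2(y² − z²). It gives B(u)v = (u₁v₂ + u₂v₁, u₀v₂ + u₂v₀, u₀v₁ +
  -- u₁v₀), for which α is the identity; the chart matrices are the regular representation of the
  -- Klein four-group.
  set p₀ : Fin 6 → ℂ := ![1, -1, 0, 0, 0, 0]
  set q₀ : Fin 6 → ℂ := ![0, 2, -2, 0, 0, 0]
  have hm : ∀ a b, Differentiable ℂ fun s : ℂ =>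
      minor (p₀ + s • (p - p₀)) (q₀ + s • (q - q₀)) a b := by
    intro a b
    simp only [minor, Pi.add_apply, Pi.smul_apply, smul_eq_mul]
    fun_prop
  have hE : ∀ i j k, Differentiable ℂ fun s : ℂ =>
      coneEntry (minor (p₀ + s • (p - p₀)) (q₀ + s • (q - q₀))) i j k := by
    intro i j k
    simp only [coneEntry]
    fun_prop
  have hA : ∀ i j, Differentiable ℂ fun s : ℂ =>
      sliceAlpha (coneEntry (minor (p₀ + s • (p - p₀)) (q₀ + s • (q - q₀)))) i j := by
    intro i j
    simp only [sliceAlpha]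
    fun_prop
  have h := chartPoint_mem_red_of_line
    (c := fun s => sliceCoord (minor (p₀ + s • (p - p₀)) (q₀ + s • (q - q₀))))
    (D := fun s => (Matrix.of (sliceAlpha
      (coneEntry (minor (p₀ + s • (p - p₀)) (q₀ + s • (q - q₀)))))).det)
    ?_ ?_ ?_ (fun s hs => chartPoint_mem_redOpen _ _ hs) 1
  · simpa using h
  · refine continuous_pi ?_
    rintro (⟨i, k, j⟩ | ⟨i, j⟩)
    · exact (hE i j k).continuous
    · exact (hA i j).continuous
  · simp only [Matrix.det_fin_three, Matrix.of_apply]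
    fun_prop
  · simp [Matrix.det_fin_three, sliceAlpha, coneEntry, symIdx, minor, p₀, q₀, Fin.sum_univ_three]

/-! ### The slice -/

theorem redSlice_eq (φ : Sl I4 ≃ₗ⁅ℂ⁆ Sl I4) :
    redSlice φ = {c | ∃ p q : Fin 6 → ℂ, c = sliceCoord (minor p q)} := by
  ext c
  rw [redSlice, Set.mem_ofPred_eq, map_mem_red_iff]
  constructor
  · rintro ⟨hN, hr⟩
    refine exists_eq_sliceCoord hN fun u v => ?_
    exact sl_lie_eq_zero.mp (lie_eq_zero_of_mem_red hr (mem_chartPoint.mpr ⟨u, rfl⟩)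
      (mem_chartPoint.mpr ⟨v, rfl⟩))
  · rintro ⟨p, q, rfl⟩
    exact ⟨sliceCoord_mem_normalSlice _ (minor_skew p q), chartPoint_sliceCoord_mem_red p q⟩

/-! ### The tangent cone of a quasi-homogeneous graph -/

theorem aeval_smul_of_isHomogeneous {σ : Type*} {f : MvPolynomial σ ℂ} {d : ℕ}
    (hf : f.IsHomogeneous d) (t : ℂ) (y : σ → ℂ) :
    MvPolynomial.aeval (t • y) f = t ^ d * MvPolynomial.aeval y f := by
  rw [MvPolynomial.aeval_def, MvPolynomial.aeval_def, MvPolynomial.eval₂_eq, MvPolynomial.eval₂_eq,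
    Finset.mul_sum]
  refine Finset.sum_congr rfl fun s hs => ?_
  simp only [Pi.smul_apply, smul_eq_mul, mul_pow, Finset.prod_mul_distrib, Finset.prod_pow_eq_pow_sum,
    ← hf.degree_eq_sum_deg_support hs]
  ring

theorem aeval_smul_eq_sum {σ : Type*} (f : MvPolynomial σ ℂ) (t : ℂ) (y : σ → ℂ) :
    MvPolynomial.aeval (t • y) f = ∑ e ∈ Finset.range (f.totalDegree + 1),
      t ^ e * MvPolynomial.aeval y (homogeneousComponent e f) := by
  conv_lhs => rw [← MvPolynomial.sum_homogeneousComponent f]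
  rw [map_sum]
  exact Finset.sum_congr rfl fun e _ =>
    aeval_smul_of_isHomogeneous (MvPolynomial.homogeneousComponent_isHomogeneous e f) t y

/-- The vanishing ideal of a cone is homogeneous. -/
theorem homogeneousComponent_mem_vanishingIdeal {σ : Type*} {Γ : Set (σ → ℂ)}
    (hΓ : ∀ y ∈ Γ, ∀ t : ℂ, t • y ∈ Γ) {f : MvPolynomial σ ℂ} (hf : f ∈ vanishingIdeal ℂ Γ) (e : ℕ) :
    homogeneousComponent e f ∈ vanishingIdeal ℂ Γ := by
  intro y hy
  by_cases he : e < f.totalDegree + 1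
  · have h0 : (∑ e ∈ Finset.range (f.totalDegree + 1), Polynomial.C
        (MvPolynomial.aeval y (homogeneousComponent e f)) * Polynomial.X ^ e) = 0 := by
      apply Polynomial.funext
      intro t
      simp only [Polynomial.eval_finsetSum, Polynomial.eval_mul, Polynomial.eval_C,
        Polynomial.eval_pow, Polynomial.eval_X, Polynomial.eval_zero, mul_comm _ (t ^ _)]
      rw [← aeval_smul_eq_sum]
      exact hf _ (hΓ y hy t)
    have := congrArg (fun P => Polynomial.coeff P e) h0
    simpa [Polynomial.finsetSum_coeff, Polynomial.coeff_C_mul, Polynomial.coeff_X_pow, he]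
      using this
  · rw [MvPolynomial.homogeneousComponent_eq_zero e f (by omega), map_zero]

section Graph

variable {ι κ : Type} (S : Set (ι → ℂ)) (Q : κ → MvPolynomial ι ℂ)

/-- The graph over `S` of the polynomial map `Q`. -/
def graphOver : Set (ι ⊕ κ → ℂ) :=
  {c | ∃ a ∈ S, c = Sum.elim a fun k => MvPolynomial.aeval a (Q k)}

/-- The embedding of `S` in the product by the zero section. -/
def zeroSection : Set (ι ⊕ κ → ℂ) := {c | ∃ a ∈ S, c = Sum.elim a 0}

/-- The tangent cone at the vertex of a graph of quadratic forms over a cone is the cone. -/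
theorem tangentConeIdeal_graphOver (hS : ∀ a ∈ S, ∀ t : ℂ, t • a ∈ S)
    (hQ : ∀ k, (Q k).IsHomogeneous 2) :
    tangentConeIdeal (graphOver S Q) 0 = vanishingIdeal ℂ (zeroSection (κ := κ) S) := by
  have himg : (fun y => y - 0) '' graphOver S Q = graphOver S Q := by simp
  rw [tangentConeIdeal, himg]
  apply le_antisymm
  · rw [Ideal.span_le]
    rintro _ ⟨f, hf, d, hd, rfl⟩ _ ⟨a, ha, rfl⟩
    by_cases hdf : d < f.totalDegree + 1
    swap
    · rw [MvPolynomial.homogeneousComponent_eq_zero d f (by omega), map_zero]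
    -- Write the graph point over t·a as t·y(t), with y(0) = (a, 0). Dividing f(t·y(t)) = 0 by t to
    -- the power d and letting t tend to 0 leaves the component of degree d at (a, 0).
    set y : ℂ → ι ⊕ κ → ℂ := fun t =>
      Sum.elim a fun k => t * MvPolynomial.aeval a (Q k) with hy
    have hyX : ∀ t : ℂ, t • y t ∈ graphOver S Q := by
      intro t
      refine ⟨t • a, hS a ha t, ?_⟩
      ext (i | k)
      · rfl
      · simp only [hy, Pi.smul_apply, Sum.elim_inr, smul_eq_mul,
          aeval_smul_of_isHomogeneous (hQ k)]
        ring
    have hyc : Continuous y := by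
      refine continuous_pi ?_
      rintro (i | k)
      · exact continuous_const
      · exact continuous_id.mul continuous_const
    -- The truncated exponent e − d is harmless: the components with e < d are zero.
    set h : ℂ → ℂ := fun t => ∑ e ∈ Finset.range (f.totalDegree + 1),
      t ^ (e - d) * MvPolynomial.aeval (y t) (homogeneousComponent e f) with hh
    have hc : Continuous h := by
      refine continuous_finsetSum _ fun e _ => (continuous_pow _).mul ?_
      simp only [MvPolynomial.aeval_eq_eval]
      exact (MvPolynomial.continuous_eval _).comp hyc
    have hmul : ∀ t, t ^ d * h t = MvPolynomial.aeval (t • y t) f := by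
      intro t
      rw [aeval_smul_eq_sum, hh, Finset.mul_sum]
      refine Finset.sum_congr rfl fun e _ => ?_
      by_cases hed : e < d
      · simp [hd e hed]
      · rw [← mul_assoc, ← pow_add, Nat.add_sub_cancel' (by omega)]
    have h0 : ∀ t, t ≠ 0 → h t = 0 := by
      intro t ht
      have := hmul t
      rw [hf _ (hyX t)] at this
      exact (mul_eq_zero.mp this).resolve_left (pow_ne_zero _ ht)
    have hh0 : h 0 = 0 := by
      have h1 : Filter.Tendsto h (nhdsWithin 0 {0}ᶜ) (nhds (h 0)) :=
        (hc.tendsto 0).mono_left nhdsWithin_le_nhds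
      refine tendsto_nhds_unique h1 (tendsto_const_nhds.congr' ?_)
      filter_upwards [self_mem_nhdsWithin] with t ht
      exact (h0 t ht).symm
    have hy0 : y 0 = Sum.elim a 0 := by
      ext (i | k) <;> simp [hy]
    have hsum : h 0 = MvPolynomial.aeval (y 0) (homogeneousComponent d f) := by
      simp only [hh]
      rw [Finset.sum_eq_single d]
      · simp
      · intro e _ hed
        rcases lt_or_gt_of_ne hed with hlt | hgt
        · simp [hd e hlt]
        · rw [zero_pow (by omega), zero_mul]
      · intro hnot
        exact absurd (Finset.mem_range.mpr hdf) hnot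
    rw [← hy0, ← hsum, hh0]
  · set I : Ideal (MvPolynomial (ι ⊕ κ) ℂ) := Ideal.span
      {g | ∃ f ∈ vanishingIdeal ℂ (graphOver S Q), ∃ d : ℕ,
        (∀ e < d, homogeneousComponent e f = 0) ∧ g = homogeneousComponent d f} with hI
    -- The equation of the graph, variable minus quadratic form, has that variable as its initial
    -- form.
    have hX : ∀ k : κ, (MvPolynomial.X (Sum.inr k) : MvPolynomial (ι ⊕ κ) ℂ) ∈ I := by
      intro k
      have hQk : (MvPolynomial.rename (Sum.inl : ι → ι ⊕ κ) (Q k)).IsHomogeneous 2 :=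
        (hQ k).rename_isHomogeneous
      have h1 := MvPolynomial.isHomogeneous_X ℂ (Sum.inr k : ι ⊕ κ)
      refine Ideal.subset_span
        ⟨MvPolynomial.X (Sum.inr k) - MvPolynomial.rename Sum.inl (Q k), ?_, 1, ?_, ?_⟩
      · rintro _ ⟨a, ha, rfl⟩
        simp only [map_sub, MvPolynomial.aeval_X, MvPolynomial.aeval_rename, Sum.elim_inr]
        rw [Sum.elim_comp_inl, sub_self]
      · intro e he
        rw [map_sub, MvPolynomial.homogeneousComponent_of_mem h1,
          MvPolynomial.homogeneousComponent_of_mem hQk, if_neg (by omega), if_neg (by omega), sub_zero]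
      · rw [map_sub, MvPolynomial.homogeneousComponent_of_mem h1,
          MvPolynomial.homogeneousComponent_of_mem hQk, if_pos rfl, if_neg (by omega), sub_zero]
    have hcone : ∀ y ∈ zeroSection (κ := κ) S, ∀ t : ℂ, t • y ∈ zeroSection (κ := κ) S := by
      rintro _ ⟨a, ha, rfl⟩ t
      refine ⟨t • a, hS a ha t, ?_⟩
      ext (i | k) <;> simp
    let ρ : MvPolynomial (ι ⊕ κ) ℂ →ₐ[ℂ] MvPolynomial (ι ⊕ κ) ℂ :=
      MvPolynomial.aeval (Sum.elim (fun i => MvPolynomial.X (Sum.inl i)) fun _ => 0)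
    have hρ : ∀ f, f - ρ f ∈ I := by
      intro f
      rw [← Ideal.Quotient.mk_eq_mk_iff_sub_mem]
      have : (Ideal.Quotient.mkₐ ℂ I) = (Ideal.Quotient.mkₐ ℂ I).comp ρ := by
        apply MvPolynomial.algHom_ext
        rintro (i | k)
        · simp [ρ]
        · simp only [AlgHom.comp_apply, ρ, MvPolynomial.aeval_X, Sum.elim_inr, map_zero]
          exact Ideal.Quotient.eq_zero_iff_mem.mpr (hX k)
      exact congrArg (fun F => F f) this
    intro f hf
    rw [← MvPolynomial.sum_homogeneousComponent f]
    refine sum_mem fun e _ => ?_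
    have hfe := homogeneousComponent_mem_vanishingIdeal hcone hf e
    set fe := homogeneousComponent e f with hfedef
    have hfeh : fe.IsHomogeneous e := MvPolynomial.homogeneousComponent_isHomogeneous e f
    have hge : (ρ fe).IsHomogeneous e := by
      have := hfeh.aeval (n := 1)
        (Sum.elim (fun i => (MvPolynomial.X (Sum.inl i) : MvPolynomial (ι ⊕ κ) ℂ)) fun _ => 0) (by
          rintro (i | k)
          · exact MvPolynomial.isHomogeneous_X _ _
          · exact MvPolynomial.isHomogeneous_zero _ _ _)
      rwa [one_mul] at this
    -- With the graph variables set to zero, a form vanishing on the cone vanishes on the graph as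
    -- well, and being homogeneous it is its own initial form.
    have hgI : ρ fe ∈ I := by
      refine Ideal.subset_span ⟨ρ fe, ?_, e, ?_, ?_⟩
      · rintro _ ⟨a, ha, rfl⟩
        have h2 := hfe _ ⟨a, ha, rfl⟩
        rw [← h2, ← AlgHom.comp_apply]
        congr 1
        apply MvPolynomial.algHom_ext
        rintro (i | k) <;> simp [ρ]
      · intro e' he'
        rw [MvPolynomial.homogeneousComponent_of_mem hge, if_neg (by omega)]
      · rw [MvPolynomial.homogeneousComponent_of_mem hge, if_pos rfl]
    have := I.add_mem (hρ fe) hgI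
    rwa [sub_add_cancel] at this

end Graph

/-! ### The cone over the Grassmannian -/

/-- The endomorphism parts of the decomposable bivectors. -/
def coneSet : Set (Fin 3 × Fin 3 × Fin 3 → ℂ) :=
  {a | ∃ p q : Fin 6 → ℂ, a = fun t => coneEntry (minor p q) t.1 t.2.2 t.2.1}

/-- The quadratic forms that give the linear form part. -/
def alphaPoly (t : Fin 3 × Fin 3) : MvPolynomial (Fin 3 × Fin 3 × Fin 3) ℂ :=
  sliceAlpha (fun i j k => MvPolynomial.X (i, k, j)) t.1 t.2

theorem alphaPoly_isHomogeneous (t : Fin 3 × Fin 3) : (alphaPoly t).IsHomogeneous 2 := by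
  unfold alphaPoly sliceAlpha
  refine MvPolynomial.IsHomogeneous.C_mul ?_ _
  exact MvPolynomial.IsHomogeneous.sum _ _ _ fun y _ => MvPolynomial.IsHomogeneous.sum _ _ _ fun x _ =>
    (MvPolynomial.isHomogeneous_X _ _).mul (MvPolynomial.isHomogeneous_X _ _)

theorem smul_mem_coneSet (a) (ha : a ∈ coneSet) (t : ℂ) : t • a ∈ coneSet := by
  obtain ⟨p, q, rfl⟩ := ha
  refine ⟨t • p, q, ?_⟩
  ext x
  simp only [Pi.smul_apply, coneEntry, minor, smul_eq_mul]
  ring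

theorem redSlice_eq_graphOver (φ : Sl I4 ≃ₗ⁅ℂ⁆ Sl I4) :
    redSlice φ = graphOver coneSet alphaPoly := by
  have h : ∀ p q : Fin 6 → ℂ, sliceCoord (minor p q) =
      Sum.elim (fun t => coneEntry (minor p q) t.1 t.2.2 t.2.1) fun k => MvPolynomial.aeval
        (fun t : Fin 3 × Fin 3 × Fin 3 => coneEntry (minor p q) t.1 t.2.2 t.2.1) (alphaPoly k) := by
    intro p q
    ext (t | t)
    · rfl
    · simp only [sliceCoord, Sum.elim_inr, alphaPoly, sliceAlpha, map_mul, map_sum,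
        MvPolynomial.aeval_X, AlgHom.commutes]
  rw [redSlice_eq]
  ext c
  constructor
  · rintro ⟨p, q, rfl⟩
    exact ⟨_, ⟨p, q, rfl⟩, h p q⟩
  · rintro ⟨_, ⟨p, q, rfl⟩, rfl⟩
    exact ⟨p, q, (h p q).symm⟩

theorem tangentConeIdeal_redSlice (φ : Sl I4 ≃ₗ⁅ℂ⁆ Sl I4) :
    tangentConeIdeal (redSlice φ) 0 =
      vanishingIdeal ℂ (zeroSection (κ := Fin 3 × Fin 3) coneSet) := by
  rw [redSlice_eq_graphOver]
  exact tangentConeIdeal_graphOver _ _ smul_mem_coneSet alphaPoly_isHomogeneous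

/-! ### Krull dimension and transcendence degree -/

/-- Going up lifts chains of primes from R to S; incomparability makes contraction strictly
monotone, which gives the other inequality. -/
theorem ringKrullDim_eq_of_isIntegral (R S : Type*) [CommRing R] [CommRing S] [Algebra R S]
    [Algebra.IsIntegral R S] [FaithfulSMul R S] : ringKrullDim R = ringKrullDim S := by
  apply le_antisymm
  · refine iSup_le fun l => ?_
    obtain ⟨P, hP, hPl⟩ := (Ideal.nonempty_primesOver (S := S) l.head.asIdeal).some
    obtain ⟨L, hL, -, -⟩ := Ideal.exists_ltSeries_of_hasGoingUp l P
    rw [← hL]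
    exact le_iSup (fun l : LTSeries (PrimeSpectrum S) => ((l.length : ℕ∞) : WithBot ℕ∞)) L
  · refine Order.krullDim_le_of_strictMono (PrimeSpectrum.comap (algebraMap R S)) ?_
    intro I J hIJ
    exact Ideal.IsIntegral.comap_lt_comap hIJ

/-- The Krull dimension of a finitely generated domain over a field is its transcendence degree. -/
theorem ringKrullDim_eq_of_isTranscendenceBasis {k A ι : Type} [Field k] [CommRing A] [IsDomain A]
    [Algebra k A] [Algebra.FiniteType k A] [Fintype ι] {x : ι → A}
    (hx : IsTranscendenceBasis k x) : ringKrullDim A = (Fintype.card ι : WithBot ℕ∞) := by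
  -- Noether normalization: the s variables form a second transcendence basis, so s is the number of
  -- elements of x.
  obtain ⟨s, g, hinj, hint⟩ := exists_integral_inj_algHom_of_fg k A
  algebraize [g.toRingHom]
  have : IsScalarTower k (MvPolynomial (Fin s) k) A := IsScalarTower.of_algHom g
  have : Algebra.IsIntegral (MvPolynomial (Fin s) k) A := ⟨hint⟩
  have : FaithfulSMul (MvPolynomial (Fin s) k) A :=
    (faithfulSMul_iff_algebraMap_injective _ _).mpr hinj
  have hy := (IsTranscendenceBasis.mvPolynomial (Fin s) k).algebraMap_comp (A := A)
  have hcard := hx.cardinalMk_eq hy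
  have hs : Fintype.card ι = s := by
    simpa using hcard
  rw [← ringKrullDim_eq_of_isIntegral (MvPolynomial (Fin s) k) A,
    MvPolynomial.ringKrullDim_of_isNoetherianRing, hs]
  simp

/-! ### The homogeneous coordinate ring -/

/-- The polynomial ring in the coordinates of a pair of vectors. -/
abbrev PairRing : Type := MvPolynomial (Fin 2 × Fin 6) ℂ

/-- The generic Plücker coordinates. -/
def genericMinor : Fin 6 → Fin 6 → PairRing :=
  minor (fun a => MvPolynomial.X (0, a)) (fun a => MvPolynomial.X (1, a))

/-- The comorphism of the parametrization of the cone over the Grassmannian. -/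
def coneHom : MvPolynomial ChartIndex ℂ →ₐ[ℂ] PairRing :=
  MvPolynomial.aeval
    (Sum.elim (fun t => coneEntry genericMinor t.1 t.2.2 t.2.1) fun _ => 0)

theorem map_coneEntry {R S : Type*} [CommRing R] [CommRing S] [Algebra ℂ R] [Algebra ℂ S]
    (f : R →ₐ[ℂ] S) (m : Fin 6 → Fin 6 → R) (i j k : Fin 3) :
    f (coneEntry m i j k) = coneEntry (fun a b => f (m a b)) i j k := by
  simp [coneEntry]

theorem map_minorsOf {R S : Type*} [CommRing R] [CommRing S] [Algebra ℂ R] [Algebra ℂ S]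
    (f : R →ₐ[ℂ] S) (b : Fin 3 → Fin 3 → Fin 3 → R) (x y : Fin 6) :
    f (minorsOf b x y) = minorsOf (fun i j k => f (b i j k)) x y := by
  fin_cases x <;> fin_cases y <;> simp [minorsOf, map_ofNat f 2]

theorem map_minor {ι R S : Type*} [CommRing R] [CommRing S] [Algebra ℂ R] [Algebra ℂ S]
    (f : R →ₐ[ℂ] S) (p q : ι → R) (a b : ι) :
    f (minor p q a b) = minor (fun a => f (p a)) (fun a => f (q a)) a b := by
  simp [minor]

/-- A polynomial vanishes on the image of the parametrization exactly when its pullback vanishes at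
every pair (p, q), hence is zero since ℂ is infinite. This identifies the coordinate ring with a
subring of a polynomial ring. -/
theorem vanishingIdeal_zeroSection_coneSet :
    vanishingIdeal ℂ (zeroSection (κ := Fin 3 × Fin 3) coneSet) = RingHom.ker coneHom := by
  have key : ∀ (p q : Fin 6 → ℂ) (f : MvPolynomial ChartIndex ℂ),
      MvPolynomial.aeval (fun t : Fin 2 × Fin 6 => ![p, q] t.1 t.2) (coneHom f) =
      MvPolynomial.aeval (Sum.elim (fun t : Fin 3 × Fin 3 × Fin 3 =>
        coneEntry (minor p q) t.1 t.2.2 t.2.1) (0 : Fin 3 × Fin 3 → ℂ)) f := by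
    intro p q f
    rw [← AlgHom.comp_apply]
    congr 1
    apply MvPolynomial.algHom_ext
    rintro (t | t)
    · simp only [AlgHom.comp_apply, coneHom, MvPolynomial.aeval_X, Sum.elim_inl, map_coneEntry,
        genericMinor, map_minor]
      rfl
    · simp [coneHom]
  ext f
  constructor
  · intro hf
    rw [RingHom.mem_ker]
    apply MvPolynomial.funext
    intro z
    have hz : z = fun t : Fin 2 × Fin 6 => ![fun a => z (0, a), fun a => z (1, a)] t.1 t.2 := by
      ext ⟨i, a⟩
      fin_cases i <;> rfl
    rw [map_zero, hz, ← MvPolynomial.aeval_eq_eval]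
    exact (key _ _ f).trans (hf _ ⟨_, ⟨_, _, rfl⟩, rfl⟩)
  · rintro hf _ ⟨_, ⟨p, q, rfl⟩, rfl⟩
    rw [← key, (RingHom.mem_ker).mp hf, map_zero]

/-- The entries of the generic traceless symmetric map, in the coordinate ring of the cone. -/
def rangeEntry (i j k : Fin 3) : coneHom.range :=
  coneHom.rangeRestrict (MvPolynomial.X (Sum.inl (i, k, j)))

/-- The Plücker coordinates in the coordinate ring of the cone. -/
def rangeMinor : Fin 6 → Fin 6 → coneHom.range := minorsOf rangeEntry

theorem rangeMinor_val (a b : Fin 6) : (rangeMinor a b : PairRing) = genericMinor a b := by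
  have h1 := map_minorsOf coneHom.range.val rangeEntry a b
  have h2 : (fun i j k => coneHom.range.val (rangeEntry i j k)) = coneEntry genericMinor := by
    ext1 i; ext1 j; ext1 k
    exact (MvPolynomial.aeval_X _ _)
  rw [h2, minorsOf_coneEntry genericMinor (minor_skew _ _)] at h1
  exact h1

theorem rangeEntry_eq (i j k : Fin 3) : rangeEntry i j k = coneEntry rangeMinor i j k := by
  apply Subtype.ext
  have h1 := map_coneEntry coneHom.range.val rangeMinor i j k
  have h2 : (fun a b => coneHom.range.val (rangeMinor a b)) = genericMinor := by
    ext1 a; ext1 b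
    exact rangeMinor_val a b
  rw [h2] at h1
  exact (MvPolynomial.aeval_X _ _).trans h1.symm

theorem rangeMinor_skew (a b : Fin 6) : rangeMinor a b = -rangeMinor b a :=
  minorsOf_skew _ a b

theorem rangeMinor_plucker (a b c d : Fin 6) : rangeMinor a b * rangeMinor c d =
    rangeMinor a c * rangeMinor b d - rangeMinor a d * rangeMinor b c := by
  apply Subtype.ext
  simp only [Subalgebra.coe_mul, Subalgebra.coe_sub, rangeMinor_val, genericMinor, minor]
  ring

/-- The last four indices of the coordinates of conics. -/
def lastIdx : Fin 4 → Fin 6 := ![2, 3, 4, 5]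

/-- Nine Plücker coordinates that form a transcendence basis. -/
def rangeBasis : Option (Fin 2 × Fin 4) → coneHom.range
  | none => rangeMinor 0 1
  | some (i, j) => rangeMinor (![0, 1] i) (lastIdx j)

/-- Over the field of rational functions in nine variables, the pair p, q below has exactly these
variables as its nine chosen minors: it is the normalized basis of a plane where the first Plücker
coordinate is nonzero. -/
theorem rangeBasis_algebraicIndependent : AlgebraicIndependent ℂ rangeBasis := by
  let P := MvPolynomial (Option (Fin 2 × Fin 4)) ℂ
  let K := FractionRing P
  let y : Option (Fin 2 × Fin 4) → K := fun i => algebraMap P K (MvPolynomial.X i)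
  let p : Fin 6 → K := ![1, 0, -(y (some (1, 0)) / y none), -(y (some (1, 1)) / y none),
    -(y (some (1, 2)) / y none), -(y (some (1, 3)) / y none)]
  let q : Fin 6 → K := ![0, y none, y (some (0, 0)), y (some (0, 1)), y (some (0, 2)),
    y (some (0, 3))]
  let f : coneHom.range →ₐ[ℂ] K :=
    (MvPolynomial.aeval (fun t : Fin 2 × Fin 6 => ![p, q] t.1 t.2)).comp coneHom.range.val
  have hf : ∀ a b, f (rangeMinor a b) = minor p q a b := by
    intro a b
    change MvPolynomial.aeval _ (rangeMinor a b : PairRing) = _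
    rw [rangeMinor_val, genericMinor, map_minor]
    simp
  have hy0 : y none ≠ 0 := by
    intro h
    have := (IsFractionRing.injective P K) (h.trans (map_zero _).symm)
    exact MvPolynomial.X_ne_zero _ this
  have hy : AlgebraicIndependent ℂ y :=
    (MvPolynomial.algebraicIndependent_X (Option (Fin 2 × Fin 4)) ℂ).map'
      (f := IsScalarTower.toAlgHom ℂ P K) (IsFractionRing.injective P K)
  refine AlgebraicIndependent.of_comp f ?_
  convert hy
  ext (_ | ⟨i, j⟩)
  · simp [rangeBasis, hf, minor, p, q]
  · fin_cases i <;> fin_cases j <;> simp [rangeBasis, hf, minor, p, q, lastIdx] <;>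
      rw [neg_mul, neg_neg, div_mul_cancel₀ _ hy0]

theorem isAlgebraic_of_mul_eq {R A : Type*} [CommRing R] [CommRing A] [Algebra R A] {a : A}
    (u v : R) (hu : u ≠ 0) (h : algebraMap R A u * a = algebraMap R A v) : IsAlgebraic R a := by
  refine ⟨Polynomial.C u * Polynomial.X - Polynomial.C v, fun h0 => hu ?_, ?_⟩
  · have := congrArg (fun P => Polynomial.coeff P 1) h0
    simpa [Polynomial.coeff_C] using this
  · simp [h]

/-- The relation m₀₁ m_cd = m₀c m₁d − m₀d m₁c expresses every Plücker coordinate rationally in the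
nine chosen ones. -/
theorem rangeBasis_isTranscendenceBasis : IsTranscendenceBasis ℂ rangeBasis := by
  rw [rangeBasis_algebraicIndependent.isTranscendenceBasis_iff_isAlgebraic]
  set B := Algebra.adjoin ℂ (Set.range rangeBasis)
  have hx : ∀ i, rangeBasis i ∈ B := fun i => Algebra.subset_adjoin ⟨i, rfl⟩
  have h01 : rangeMinor 0 1 ∈ B := hx none
  have h0 : ∀ a, rangeMinor 0 a ∈ B := by
    intro a
    fin_cases a
    · exact B.zero_mem
    · exact h01
    · exact hx (some (0, 0))
    · exact hx (some (0, 1))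
    · exact hx (some (0, 2))
    · exact hx (some (0, 3))
  have h1 : ∀ a, rangeMinor 1 a ∈ B := by
    intro a
    fin_cases a
    · change rangeMinor 1 0 ∈ B
      rw [rangeMinor_skew]
      exact B.neg_mem h01
    · exact B.zero_mem
    · exact hx (some (1, 0))
    · exact hx (some (1, 1))
    · exact hx (some (1, 2))
    · exact hx (some (1, 3))
  have hne : rangeMinor 0 1 ≠ 0 := rangeBasis_algebraicIndependent.ne_zero none
  have halg : ∀ c d, IsAlgebraic B (rangeMinor c d) := by
    intro c d
    let u : B := ⟨rangeMinor 0 1, h01⟩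
    let v : B := ⟨_, B.sub_mem (B.mul_mem (h0 c) (h1 d)) (B.mul_mem (h0 d) (h1 c))⟩
    refine isAlgebraic_of_mul_eq u v (fun h => hne (congrArg Subtype.val h)) ?_
    exact rangeMinor_plucker 0 1 c d
  have hconst : ∀ r : ℂ, IsAlgebraic B (algebraMap ℂ coneHom.range r) := fun r =>
    isAlgebraic_algebraMap (algebraMap ℂ B r)
  have hentry : ∀ i j k, IsAlgebraic B (rangeEntry i j k) := by
    intro i j k
    rw [rangeEntry_eq, coneEntry]
    exact (hconst _).mul ((halg _ _).add (halg _ _))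
  constructor
  rintro ⟨_, f, rfl⟩
  change IsAlgebraic B (coneHom.rangeRestrict f)
  induction f using MvPolynomial.induction_on with
  | C r =>
    change IsAlgebraic B (coneHom.rangeRestrict (algebraMap ℂ _ r))
    rw [AlgHom.commutes]
    exact hconst r
  | add f g hf hg => rw [map_add]; exact hf.add hg
  | mul_X f t hf =>
    rw [map_mul]
    refine hf.mul ?_
    rcases t with ⟨i, k, j⟩ | t
    · exact hentry i j k
    · have : coneHom.rangeRestrict (MvPolynomial.X (Sum.inr t)) = 0 := by
        apply Subtype.ext
        exact MvPolynomial.aeval_X _ _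
      rw [this]
      exact isAlgebraic_zero

theorem isPrime_vanishingIdeal_coneSet :
    (vanishingIdeal ℂ (zeroSection (κ := Fin 3 × Fin 3) coneSet)).IsPrime := by
  rw [vanishingIdeal_zeroSection_coneSet]
  exact RingHom.ker_isPrime _

theorem hasProjectiveDimension_coneSet : HasProjectiveDimension
    (vanishingIdeal ℂ (zeroSection (κ := Fin 3 × Fin 3) coneSet)) 8 := by
  have hft : Algebra.FiniteType ℂ coneHom.range :=
    Algebra.FiniteType.of_surjective coneHom.rangeRestrict coneHom.rangeRestrict_surjective
  have hd := ringKrullDim_eq_of_isTranscendenceBasis rangeBasis_isTranscendenceBasis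
  unfold HasProjectiveDimension
  rw [vanishingIdeal_zeroSection_coneSet]
  have e : (MvPolynomial ChartIndex ℂ ⧸ RingHom.ker coneHom) ≃+* coneHom.range :=
    (Ideal.quotientKerEquivRange coneHom).toRingEquiv
  rw [ringKrullDim_eq_of_ringEquiv e, hd]
  simp

/-! ### The affine cone over the Grassmannian is closed -/

/-- Symmetry, tracelessness, α = 0 and the Plücker relations are all given by polynomials in the
kernel of `coneHom`, and they already force a point to come from a decomposable bivector. -/
theorem zeroLocus_vanishingIdeal_coneSet :
    zeroLocus ℂ (vanishingIdeal ℂ (zeroSection (κ := Fin 3 × Fin 3) coneSet)) =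
      zeroSection coneSet := by
  apply Set.Subset.antisymm
  swap
  · intro c hc f hf
    exact hf c hc
  intro c hc
  let X : Fin 3 → Fin 3 → Fin 3 → MvPolynomial ChartIndex ℂ := fun i j k =>
    MvPolynomial.X (Sum.inl (i, k, j))
  have hX : ∀ i j k, coneHom (X i j k) = coneEntry genericMinor i j k := fun i j k =>
    MvPolynomial.aeval_X _ _
  have hcX : ∀ i j k, MvPolynomial.aeval c (X i j k) = c (Sum.inl (i, k, j)) := fun i j k =>
    MvPolynomial.aeval_X _ _
  have hker : ∀ f, coneHom f = 0 → MvPolynomial.aeval c f = 0 := by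
    intro f hf
    refine hc f ?_
    rw [vanishingIdeal_zeroSection_coneSet]
    exact hf
  set b : Fin 3 → Fin 3 → Fin 3 → ℂ := fun i j k => c (Sum.inl (i, k, j)) with hb
  have hs : ∀ i j k, b i j k = b j i k := by
    intro i j k
    have := hker (X i j k - X j i k) (by rw [map_sub, hX, hX, coneEntry_comm, sub_self])
    rwa [map_sub, hcX, hcX, sub_eq_zero] at this
  have ht : ∀ i, ∑ k, b i k k = 0 := by
    intro i
    have := hker (∑ k, X i k k) (by
      rw [map_sum]
      simp only [hX]
      exact coneEntry_trace genericMinor (minor_skew _ _) i)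
    rw [map_sum] at this
    simpa only [hcX] using this
  have h0 : ∀ t : Fin 3 × Fin 3, c (Sum.inr t) = 0 := by
    intro t
    have := hker (MvPolynomial.X (Sum.inr t)) (MvPolynomial.aeval_X _ _)
    rwa [MvPolynomial.aeval_X] at this
  have hpl : ∀ a₁ a₂ a₃ a₄, pluckerRel (minorsOf b) a₁ a₂ a₃ a₄ = 0 := by
    intro a₁ a₂ a₃ a₄
    have h1 : ∀ x y, coneHom (minorsOf X x y) = genericMinor x y := by
      intro x y
      rw [map_minorsOf]
      simp only [hX]
      exact minorsOf_coneEntry genericMinor (minor_skew _ _) x y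
    have h2 : ∀ x y, MvPolynomial.aeval c (minorsOf X x y) = minorsOf b x y := by
      intro x y
      rw [map_minorsOf]
      simp only [hcX]
      rfl
    have := hker (pluckerRel (minorsOf X) a₁ a₂ a₃ a₄) (by
      simp only [pluckerRel, map_add, map_sub, map_mul, h1]
      exact pluckerRel_minor _ _ _ _ _ _)
    simpa only [pluckerRel, map_add, map_sub, map_mul, h2] using this
  obtain ⟨p, q, hm⟩ := exists_eq_minor _ hpl
  refine ⟨_, ⟨p, q, rfl⟩, ?_⟩
  ext (⟨i, k, j⟩ | t)
  · rw [← hm]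
    exact (coneEntry_minorsOf b hs ht i j k).symm
  · exact h0 t

/-! ### Coordinates on conics -/

/-- The entries of the symmetric matrix of a quadratic form. -/
def symEntry (i j : Fin 3) : Conics →ₗ[ℂ] ℂ where
  toFun q := QuadraticMap.associated q (Pi.single i 1) (Pi.single j 1)
  map_add' p q := by simp
  map_smul' t q := by simp

theorem symEntry_apply (i j : Fin 3) (q : Conics) :
    symEntry i j q = QuadraticMap.associated (R := ℂ) q (Pi.single i 1) (Pi.single j 1) := rfl

theorem symEntry_comm (i j : Fin 3) (q : Conics) : symEntry i j q = symEntry j i q :=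
  QuadraticMap.associated_isSymm ℂ q _ _

/-- The coordinates of a quadratic form. -/
def conicCoord : Conics →ₗ[ℂ] (Fin 6 → ℂ) :=
  LinearMap.pi ![symEntry 0 0, symEntry 1 1, symEntry 2 2, symEntry 1 2, symEntry 0 2, symEntry 0 1]

theorem conicCoord_symIdx (q : Conics) (i j : Fin 3) :
    conicCoord q (symIdx i j) = symEntry i j q := by
  fin_cases i <;> fin_cases j <;> first | rfl | exact symEntry_comm _ _ q

/-- The quadratic form with given coordinates. -/
def conicOf : (Fin 6 → ℂ) →ₗ[ℂ] Conics where
  toFun p := ∑ i, ∑ j, p (symIdx i j) •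
    QuadraticMap.linMulLin (LinearMap.proj i : U →ₗ[ℂ] ℂ) (LinearMap.proj j)
  map_add' p q := by simp [add_smul, Finset.sum_add_distrib]
  map_smul' t p := by simp [Finset.smul_sum, mul_smul]

theorem associated_eq_sum (q : Conics) (u v : U) :
    QuadraticMap.associated (R := ℂ) q u v = ∑ i, ∑ j, u i * v j * symEntry i j q := by
  conv_lhs => rw [pi_eq_sum_univ' u, pi_eq_sum_univ' v]
  simp only [map_sum, LinearMap.sum_apply, map_smul, LinearMap.smul_apply, smul_eq_mul,
    symEntry_apply]
  rw [Finset.sum_comm]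
  refine Finset.sum_congr rfl fun i _ => ?_
  rw [Finset.mul_sum]
  exact Finset.sum_congr rfl fun j _ => by ring

theorem conicOf_conicCoord (q : Conics) : conicOf (conicCoord q) = q := by
  ext u
  rw [← QuadraticMap.associated_eq_self_apply ℂ q u, associated_eq_sum]
  simp only [conicOf, LinearMap.coe_mk, AddHom.coe_mk, _root_.sum_apply,
    _root_.smul_apply, QuadraticMap.linMulLin_apply, LinearMap.proj_apply, conicCoord_symIdx,
    smul_eq_mul]
  exact Finset.sum_congr rfl fun i _ => Finset.sum_congr rfl fun j _ => by ring

theorem symEntry_conicOf (p : Fin 6 → ℂ) (i j : Fin 3) :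
    symEntry i j (conicOf p) = p (symIdx i j) := by
  have h2 : QuadraticMap.associated (R := ℂ) (conicOf p) (Pi.single i 1) (Pi.single j 1) =
      (p (symIdx i j) + p (symIdx j i)) / 2 := by
    simp only [conicOf, LinearMap.coe_mk, AddHom.coe_mk, map_sum, map_smul,
      QuadraticMap.associated_linMulLin, LinearMap.sum_apply, LinearMap.smul_apply]
    simp [Pi.single_apply, Finset.sum_add_distrib, mul_add]
    ring
  rw [symEntry_apply, h2, symIdx_comm j i]; ring

theorem conicCoord_conicOf (p : Fin 6 → ℂ) : conicCoord (conicOf p) = p := by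
  ext a
  obtain ⟨i, j, rfl⟩ : ∃ i j, symIdx i j = a := by revert a; decide
  rw [conicCoord_symIdx, symEntry_conicOf]

/-- Quadratic forms are determined by their six coordinates. -/
def conicEquiv : Conics ≃ₗ[ℂ] (Fin 6 → ℂ) :=
  { conicCoord with
    invFun := conicOf
    left_inv := conicOf_conicCoord
    right_inv := conicCoord_conicOf }

/-- The basis of the space of quadratic forms that is dual to the coordinates. -/
def conicBasis : Module.Basis (Fin 6) ℂ Conics := Module.Basis.ofEquivFun conicEquiv

theorem conicCoord_conicBasis (a b : Fin 6) :
    conicCoord (conicBasis a) b = if b = a then 1 else 0 := by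
  have : conicBasis a = conicOf (Pi.single a 1) := by
    rw [conicBasis, Module.Basis.coe_ofEquivFun]; rfl
  rw [this, conicCoord_conicOf, Pi.single_apply]

/-! ### Plücker coordinates of bivectors -/

/-- The Plücker coordinate of a bivector of conics. -/
def minorForm (a b : Fin 6) : ⋀[ℂ]^2 Conics →ₗ[ℂ] ℂ :=
  exteriorPower.alternatingMapLinearEquiv
    ((Matrix.detRowAlternating (n := Fin 2) (R := ℂ)).compLinearMap
      (LinearMap.pi ![LinearMap.proj a ∘ₗ conicCoord, LinearMap.proj b ∘ₗ conicCoord]))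

theorem minorForm_wedgeConics (a b : Fin 6) (p q : Conics) :
    minorForm a b (wedgeConics p q) = minor (conicCoord p) (conicCoord q) a b := by
  rw [minorForm, wedgeConics, exteriorPower.alternatingMapLinearEquiv_apply_ιMulti]
  refine (Matrix.det_fin_two (R := ℂ) _).trans ?_
  simp [minor]

theorem wedgeConics_induction {P : ⋀[ℂ]^2 Conics → Prop} (hw : ∀ p q, P (wedgeConics p q))
    (h0 : P 0) (hadd : ∀ x y, P x → P y → P (x + y)) (hsmul : ∀ (t : ℂ) x, P x → P (t • x))
    (ω : ⋀[ℂ]^2 Conics) : P ω := by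
  have hω : ω ∈ Submodule.span ℂ (Set.range (exteriorPower.ιMulti ℂ 2 (M := Conics))) := by
    rw [exteriorPower.ιMulti_span]; trivial
  induction hω using Submodule.span_induction with
  | mem x hx =>
    obtain ⟨v, rfl⟩ := hx
    have : v = ![v 0, v 1] := by ext i; fin_cases i <;> rfl
    rw [this]
    exact hw _ _
  | zero => exact h0
  | add x y _ _ hx hy => exact hadd x y hx hy
  | smul t x _ hx => exact hsmul t x hx

theorem minorForm_skew (ω : ⋀[ℂ]^2 Conics) (a b : Fin 6) :
    minorForm a b ω = -minorForm b a ω := by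
  induction ω using wedgeConics_induction with
  | hw p q => rw [minorForm_wedgeConics, minorForm_wedgeConics, minor_skew]
  | h0 => simp
  | hadd x y hx hy => rw [map_add, map_add, hx, hy]; ring
  | hsmul t x hx => rw [map_smul, map_smul, hx, smul_neg]

/-- The bivector with given Plücker coordinates. -/
def bivectorOf (m : Fin 6 → Fin 6 → ℂ) : ⋀[ℂ]^2 Conics :=
  -- The sum runs over ordered pairs, so each basis bivector occurs twice.
  ∑ a, ∑ b, ((1 / 2 : ℂ) * m a b) • wedgeConics (conicBasis a) (conicBasis b)

theorem minorForm_bivectorOf (m : Fin 6 → Fin 6 → ℂ) (hm : ∀ a b, m a b = -m b a) (a b : Fin 6) :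
    minorForm a b (bivectorOf m) = m a b := by
  simp only [bivectorOf, map_sum, map_smul, minorForm_wedgeConics, minor, conicCoord_conicBasis,
    smul_eq_mul, mul_sub, Finset.sum_sub_distrib]
  have h1 : ∑ x, ∑ y, 1 / 2 * m x y * ((if a = x then (1 : ℂ) else 0) * if b = y then 1 else 0)
      = 1 / 2 * m a b := by
    rw [Finset.sum_eq_single a, Finset.sum_eq_single b]
    · simp
    · intro y _ hy; simp [hy.symm]
    · simp
    · intro x _ hx; simp [hx.symm]
    · simp
  have h2 : ∑ x, ∑ y, 1 / 2 * m x y * ((if b = x then (1 : ℂ) else 0) * if a = y then 1 else 0)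
      = 1 / 2 * m b a := by
    rw [Finset.sum_eq_single b, Finset.sum_eq_single a]
    · simp
    · intro y _ hy; simp [hy.symm]
    · simp
    · intro x _ hx; simp [hx.symm]
    · simp
  rw [h1, h2, hm b a]; ring

theorem wedgeConics_swap (p q : Conics) : wedgeConics p q = -wedgeConics q p := by
  have h := (exteriorPower.ιMulti ℂ 2 (M := Conics)).map_swap ![q, p] (i := 0) (j := 1) (by decide)
  rw [wedgeConics, wedgeConics, ← h]
  congr 1
  ext i : 1
  fin_cases i <;> rfl

theorem bivectorOf_minorForm (ω : ⋀[ℂ]^2 Conics) :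
    bivectorOf (fun a b => minorForm a b ω) = ω := by
  let F : ⋀[ℂ]^2 Conics →ₗ[ℂ] ⋀[ℂ]^2 Conics :=
    { toFun := fun ω => bivectorOf fun a b => minorForm a b ω
      map_add' := fun x y => by
        simp [bivectorOf, mul_add, add_smul, Finset.sum_add_distrib]
      map_smul' := fun t x => by
        simp [bivectorOf, Finset.smul_sum, smul_smul, mul_left_comm] }
  have hF : F = LinearMap.id := by
    apply exteriorPower.linearMap_ext
    refine Module.Basis.ext_alternating conicBasis fun v _ => ?_
    have hv : (fun i => conicBasis (v i)) = ![conicBasis (v 0), conicBasis (v 1)] := by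
      ext i : 1; fin_cases i <;> rfl
    rw [hv]
    change bivectorOf (fun a b => minorForm a b (wedgeConics _ _)) = wedgeConics _ _
    simp only [bivectorOf, minorForm_wedgeConics, minor, conicCoord_conicBasis, mul_sub]
    have h1 : ∀ i j : Fin 6, ∑ x, ∑ y,
        (1 / 2 * ((if x = i then (1 : ℂ) else 0) * if y = j then 1 else 0)) •
          wedgeConics (conicBasis x) (conicBasis y)
        = (1 / 2 : ℂ) • wedgeConics (conicBasis i) (conicBasis j) := by
      intro i j
      rw [Finset.sum_eq_single i, Finset.sum_eq_single j]
      · simp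
      · intro y _ hy; simp [hy]
      · simp
      · intro x _ hx; simp [hx]
      · simp
    have h2 : ∀ i j : Fin 6, ∑ x, ∑ y,
        (1 / 2 * ((if y = i then (1 : ℂ) else 0) * if x = j then 1 else 0)) •
          wedgeConics (conicBasis x) (conicBasis y)
        = (1 / 2 : ℂ) • wedgeConics (conicBasis j) (conicBasis i) := by
      intro i j
      rw [Finset.sum_eq_single j, Finset.sum_eq_single i]
      · simp
      · intro y _ hy; simp [hy]
      · simp
      · intro x _ hx; simp [hx]
      · simp
    have h3 : ∀ (s t : ℂ) (w : ⋀[ℂ]^2 Conics), (s - t) • w = s • w - t • w :=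
      fun s t w => sub_smul s t w
    simp only [h3, Finset.sum_sub_distrib]
    rw [h1, h2, wedgeConics_swap (conicBasis (v 1)), smul_neg, sub_neg_eq_add, ← add_smul]
    norm_num
  exact LinearMap.congr_fun hF ω

/-! ### Bivectors of conics as traceless symmetric maps -/

/-- The traceless symmetric map that corresponds to the Plücker coordinates `m`. -/
def tracelessOf (m : Fin 6 → Fin 6 → ℂ) (hm : ∀ a b, m a b = -m b a) : tracelessSym :=
  ⟨{ toFun := fun u => Matrix.of fun k j => ∑ i, u i * coneEntry m i j k
     map_add' := fun u v => by
       ext k j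
       simp [add_mul, Finset.sum_add_distrib]
     map_smul' := fun t u => by
       ext k j
       simp [Finset.mul_sum, mul_assoc] }, by
    refine ⟨fun u v => ?_, fun u => ?_⟩
    · ext k
      simp only [LinearMap.coe_mk, AddHom.coe_mk, Matrix.mulVec, dotProduct, Matrix.of_apply,
        Finset.sum_mul]
      rw [Finset.sum_comm]
      refine Finset.sum_congr rfl fun i _ => Finset.sum_congr rfl fun j _ => ?_
      rw [coneEntry_comm m i j]
      ring
    · simp only [LinearMap.coe_mk, AddHom.coe_mk, Matrix.trace, Matrix.diag, Matrix.of_apply]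
      rw [Finset.sum_comm]
      simp only [← Finset.mul_sum, coneEntry_trace m hm, mul_zero, Finset.sum_const_zero]⟩

theorem tracelessOf_apply (m : Fin 6 → Fin 6 → ℂ) (hm : ∀ a b, m a b = -m b a) (u : U)
    (k j : Fin 3) : (tracelessOf m hm).val u k j = ∑ i, u i * coneEntry m i j k := rfl

theorem tracelessOf_single (m : Fin 6 → Fin 6 → ℂ) (hm : ∀ a b, m a b = -m b a) (i k j : Fin 3) :
    (tracelessOf m hm).val (Pi.single i 1) k j = coneEntry m i j k := by
  rw [tracelessOf_apply, Finset.sum_eq_single i]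
  · simp
  · intro b _ hb; simp [hb]
  · simp

theorem tracelessSym_ext {B C : tracelessSym}
    (h : ∀ i k j, B.val (Pi.single i 1) k j = C.val (Pi.single i 1) k j) : B = C := by
  apply Subtype.ext
  refine LinearMap.pi_ext' fun i => LinearMap.ext_ring ?_
  ext k j
  exact h i k j

/-- The linear map underlying the isomorphism from bivectors of conics to traceless symmetric
maps. -/
def bivectorMap : ⋀[ℂ]^2 Conics →ₗ[ℂ] tracelessSym where
  toFun ω := tracelessOf (fun a b => minorForm a b ω) (minorForm_skew ω)
  map_add' x y := by
    refine tracelessSym_ext fun i k j => ?_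
    change _ = (tracelessOf _ _).val _ k j + (tracelessOf _ _).val _ k j
    simp only [tracelessOf_single, coneEntry, map_add]
    ring
  map_smul' t x := by
    refine tracelessSym_ext fun i k j => ?_
    change _ = t * (tracelessOf _ _).val _ k j
    simp only [tracelessOf_single, coneEntry, map_smul, smul_eq_mul]
    ring

theorem bivectorMap_single (ω : ⋀[ℂ]^2 Conics) (i k j : Fin 3) :
    (bivectorMap ω).val (Pi.single i 1) k j = coneEntry (fun a b => minorForm a b ω) i j k :=
  tracelessOf_single _ (minorForm_skew ω) i k j

theorem bivectorMap_injective : Function.Injective bivectorMap := by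
  intro x y h
  have hc : coneEntry (fun a b => minorForm a b x) = coneEntry (fun a b => minorForm a b y) := by
    ext i j k
    rw [← bivectorMap_single, h, bivectorMap_single]
  rw [← bivectorOf_minorForm x, ← bivectorOf_minorForm y]
  congr 1
  ext a b
  rw [← minorsOf_coneEntry _ (minorForm_skew x), hc, minorsOf_coneEntry _ (minorForm_skew y)]

theorem bivectorMap_surjective : Function.Surjective bivectorMap := by
  intro B
  set b : Fin 3 → Fin 3 → Fin 3 → ℂ := fun i j k => B.val (Pi.single i 1) k j with hb
  have hs : ∀ i j k, b i j k = b j i k := by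
    intro i j k
    have := congrFun (B.2.1 (Pi.single i 1) (Pi.single j 1)) k
    simpa [hb] using this
  have ht : ∀ i, ∑ k, b i k k = 0 := fun i => B.2.2 (Pi.single i 1)
  refine ⟨bivectorOf (minorsOf b), tracelessSym_ext fun i k j => ?_⟩
  rw [bivectorMap_single]
  have : (fun a c => minorForm a c (bivectorOf (minorsOf b))) = minorsOf b := by
    ext a c
    exact minorForm_bivectorOf _ (minorsOf_skew b) a c
  rw [this, coneEntry_minorsOf b hs ht]

/-- The isomorphism from bivectors of conics to traceless symmetric maps. -/
def bivectorEquiv : ⋀[ℂ]^2 Conics ≃ₗ[ℂ] tracelessSym :=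
  LinearEquiv.ofBijective bivectorMap ⟨bivectorMap_injective, bivectorMap_surjective⟩

theorem finrank_tracelessSym : Module.finrank ℂ tracelessSym = 15 := by
  have : Module.Finite ℂ Conics := Module.Finite.of_basis conicBasis
  have : Module.Free ℂ Conics := Module.Free.of_basis conicBasis
  rw [← bivectorEquiv.finrank_eq, exteriorPower.finrank_eq, conicEquiv.finrank_eq,
    Module.finrank_fin_fun]
  decide

/-! ### The equivariance of the isomorphism -/

/-- The linear form on `U` obtained by contracting a quadratic form with a vector, in
coordinates. -/
def polarVec (p : Conics) (u : U) : Fin 3 → ℂ :=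
  fun a => QuadraticMap.associated (R := ℂ) p (Pi.single a 1) u

theorem polarVec_apply (p : Conics) (u : U) (a : Fin 3) :
    polarVec p u a = ∑ i, u i * conicCoord p (symIdx a i) := by
  rw [polarVec, associated_eq_sum, Finset.sum_eq_single a]
  · simp [conicCoord_symIdx]
  · intro b _ hb; simp [hb]
  · simp

/-- The formula behind `coneEntry`, without coordinates on W; both the normalization on squares of
linear forms and the equivariance are read off from it. -/
theorem bivectorEquiv_wedgeConics (p q : Conics) (u v : U) :
    (bivectorEquiv (wedgeConics p q)).val u *ᵥ v =
      (1 / 2 : ℂ) • (crossProduct (polarVec p u) (polarVec q v)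
        + crossProduct (polarVec p v) (polarVec q u)) := by
  ext k
  have h : ((bivectorEquiv (wedgeConics p q)).val u *ᵥ v) k =
      ∑ j, (∑ i, u i * coneEntry (minor (conicCoord p) (conicCoord q)) i j k) * v j := by
    have hm : minor (conicCoord p) (conicCoord q) =
        fun a b => minorForm a b (wedgeConics p q) := by
      ext a b
      rw [minorForm_wedgeConics]
    rw [hm]
    rfl
  rw [h]
  simp only [Pi.smul_apply, Pi.add_apply, smul_eq_mul, cross_apply, polarVec_apply, coneEntry, minor,
    Fin.sum_univ_three, Algebra.algebraMap_self, RingHom.id_apply]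
  fin_cases k <;> simp [symIdx] <;> ring

theorem polarVec_sqForm (e : Module.Dual ℂ U) (u : U) :
    polarVec (sqForm e) u = e u • fun i => e (Pi.single i 1) := by
  ext a
  simp [polarVec, sqForm, QuadraticMap.associated_linMulLin]
  ring

theorem bivectorEquiv_sqForm (e f : Module.Dual ℂ U) (u : U) :
    (bivectorEquiv (wedgeConics (sqForm e) (sqForm f))).val u *ᵥ u =
      (e u * f u) • wedgeVec e f := by
  rw [bivectorEquiv_wedgeConics, polarVec_sqForm, polarVec_sqForm, ← two_smul ℂ, smul_smul,
    LinearMap.map_smul₂, map_smul, smul_smul, smul_smul,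
    wedgeVec]
  norm_num

/-- Pairing with z turns both sides into triple products, and the transpose of N multiplies a triple
product by det N. Applied to the inverse of g, this is the source of the factor det(g)⁻¹. -/
theorem mulVec_crossProduct_transpose (N : Matrix (Fin 3) (Fin 3) ℂ) (x y : Fin 3 → ℂ) :
    N *ᵥ (crossProduct (Nᵀ *ᵥ x) (Nᵀ *ᵥ y)) = N.det • crossProduct x y := by
  ext k
  fin_cases k <;>
    simp [cross_apply, Matrix.mulVec, dotProduct, Fin.sum_univ_three, Matrix.det_fin_three] <;> ring

theorem polarVec_actConics (g : U ≃ₗ[ℂ] U) (p : Conics) (u : U) :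
    polarVec (actConics g p) u =
      (LinearMap.toMatrix' (g.symm : U →ₗ[ℂ] U))ᵀ *ᵥ polarVec p (g.symm u) := by
  ext a
  have h : polarVec (actConics g p) u a =
      QuadraticMap.associated (R := ℂ) p (g.symm (Pi.single a 1)) (g.symm u) := by
    change QuadraticMap.associated (p.comp (g.symm : U →ₗ[ℂ] U)) _ _ = _
    rw [QuadraticMap.associated_comp]
    rfl
  rw [h]
  conv_lhs => rw [pi_eq_sum_univ' (g.symm (Pi.single a 1))]
  simp only [map_sum, LinearMap.sum_apply, map_smul, LinearMap.smul_apply, smul_eq_mul,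
    Matrix.mulVec, dotProduct, Matrix.transpose_apply, LinearMap.toMatrix'_apply, polarVec]
  rfl

theorem crossProduct_polarVec_actConics (g : U ≃ₗ[ℂ] U) (p q : Conics) (u v : U) :
    crossProduct (polarVec (actConics g p) u) (polarVec (actConics g q) v) =
      (LinearMap.det (g : U →ₗ[ℂ] U))⁻¹ •
        g (crossProduct (polarVec p (g.symm u)) (polarVec q (g.symm v))) := by
  apply g.symm.injective
  rw [map_smul, LinearEquiv.symm_apply_apply, polarVec_actConics, polarVec_actConics]
  have h := mulVec_crossProduct_transpose (LinearMap.toMatrix' (g.symm : U →ₗ[ℂ] U))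
    (polarVec p (g.symm u)) (polarVec q (g.symm v))
  rw [LinearMap.toMatrix'_mulVec, LinearMap.det_toMatrix'] at h
  have hd : (LinearMap.det (g : U →ₗ[ℂ] U))⁻¹ = LinearMap.det (g.symm : U →ₗ[ℂ] U) := by
    exact inv_eq_of_mul_eq_one_right (LinearEquiv.det_mul_det_symm g)
  rw [hd]
  exact h

theorem bivectorEquiv_map (g : U ≃ₗ[ℂ] U) (ω : ⋀[ℂ]^2 Conics) (u v : U) :
    (bivectorEquiv (exteriorPower.map 2 (actConics g) ω)).val u *ᵥ v =
      (LinearMap.det (g : U →ₗ[ℂ] U))⁻¹ • g ((bivectorEquiv ω).val (g.symm u) *ᵥ g.symm v) := by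
  induction ω using wedgeConics_induction with
  | hw p q =>
    have h : exteriorPower.map 2 (actConics g) (wedgeConics p q) =
        wedgeConics (actConics g p) (actConics g q) := by
      rw [wedgeConics, exteriorPower.map_apply_ιMulti, wedgeConics]
      congr 1
      ext i : 1
      fin_cases i <;> rfl
    rw [h, bivectorEquiv_wedgeConics, bivectorEquiv_wedgeConics, crossProduct_polarVec_actConics,
      crossProduct_polarVec_actConics, map_smul, map_add, ← smul_add, smul_comm]
  | h0 => simp
  | hadd x y hx hy =>
    simp only [map_add, Submodule.coe_add, LinearMap.add_apply, Matrix.add_mulVec, hx, hy, smul_add]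
  | hsmul t x hx =>
    simp only [map_smul, Submodule.coe_smul, LinearMap.smul_apply, Matrix.smul_mulVec, hx]
    rw [smul_comm]

/-! ### The tangent cone -/

theorem toChart_bivectorEquiv (ω : ⋀[ℂ]^2 Conics) :
    toChart (bivectorEquiv ω) =
      Sum.elim (fun t => coneEntry (fun a b => minorForm a b ω) t.1 t.2.2 t.2.1) 0 := by
  ext (⟨i, k, j⟩ | t)
  · exact bivectorMap_single ω i k j
  · rfl

theorem toChart_injective : Function.Injective toChart := by
  intro B C h
  exact tracelessSym_ext fun i k j => congrFun h (Sum.inl (i, k, j))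

theorem tangentCone_redSlice (φ : Sl I4 ≃ₗ⁅ℂ⁆ Sl I4) :
    tangentCone (redSlice φ) 0 = zeroSection coneSet := by
  rw [tangentCone, tangentConeIdeal_redSlice, zeroLocus_vanishingIdeal_coneSet]

theorem toChart_bivectorEquiv_mem (p q : Fin 6 → ℂ) :
    toChart (bivectorEquiv (wedgeConics (conicOf p) (conicOf q))) =
      Sum.elim (fun t => coneEntry (minor p q) t.1 t.2.2 t.2.1) 0 := by
  rw [toChart_bivectorEquiv]
  simp only [minorForm_wedgeConics, conicCoord_conicOf]

theorem tangentCone_redSlice_subset (φ : Sl I4 ≃ₗ⁅ℂ⁆ Sl I4) :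
    tangentCone (redSlice φ) 0 ⊆ Set.range toChart := by
  rw [tangentCone_redSlice]
  rintro _ ⟨_, ⟨p, q, rfl⟩, rfl⟩
  exact ⟨_, toChart_bivectorEquiv_mem p q⟩

theorem wedgeConics_smul (t : ℂ) (p q : Conics) : wedgeConics (t • p) q = t • wedgeConics p q := by
  have h := (exteriorPower.ιMulti ℂ 2 (M := Conics)).map_update_smul ![p, q] 0 t p
  have h1 : ∀ x, Function.update ![p, q] 0 x = ![x, q] := fun x => by
    ext i : 1
    fin_cases i <;> rfl
  rw [h1, h1] at h
  exact h

theorem wedgeConics_eq_zero {p q : Conics} (h : ¬ LinearIndependent ℂ ![p, q]) :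
    wedgeConics p q = 0 :=
  AlternatingMap.map_linearDependent _ _ h

/-- The cone is the image of all decomposable bivectors; a nonzero one comes from an independent
pair, and scalars on the line are absorbed into the first conic. -/
theorem image_pencils (φ : Sl I4 ≃ₗ⁅ℂ⁆ Sl I4) :
    Projectivization.map bivectorEquiv.toLinearMap bivectorEquiv.injective '' pencils = C4 φ := by
  ext x
  constructor
  · rintro ⟨y, ⟨p, q, -, hy⟩, rfl⟩ B hB
    induction y using Projectivization.ind with
    | h ω hω =>
    rw [Projectivization.map_mk, Projectivization.submodule_mk] at hB
    rw [Projectivization.submodule_mk] at hy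
    obtain ⟨t, rfl⟩ := Submodule.mem_span_singleton.mp hB
    have : t • ω ∈ Submodule.span ℂ {wedgeConics p q} := by
      rw [← hy]
      exact Submodule.mem_span_singleton.mpr ⟨t, rfl⟩
    obtain ⟨s, hs⟩ := Submodule.mem_span_singleton.mp this
    have h2 : t • bivectorEquiv.toLinearMap ω =
        bivectorEquiv (wedgeConics (conicOf (conicCoord (s • p))) (conicOf (conicCoord q))) := by
      rw [conicOf_conicCoord, conicOf_conicCoord, wedgeConics_smul, hs, map_smul]
      rfl
    rw [tangentCone_redSlice, h2, toChart_bivectorEquiv_mem]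
    exact ⟨_, ⟨_, _, rfl⟩, rfl⟩
  · intro hx
    induction x using Projectivization.ind with
    | h B hB =>
    have hB' := hx B (by rw [Projectivization.submodule_mk]; exact Submodule.mem_span_singleton_self B)
    rw [tangentCone_redSlice] at hB'
    obtain ⟨_, ⟨p, q, rfl⟩, h⟩ := hB'
    rw [← toChart_bivectorEquiv_mem] at h
    have hBw := toChart_injective h
    have hw : wedgeConics (conicOf p) (conicOf q) ≠ 0 := by
      intro h0
      rw [h0, map_zero] at hBw
      exact hB hBw
    refine ⟨Projectivization.mk ℂ _ hw, ⟨_, _, ?_, Projectivization.submodule_mk _ _⟩, ?_⟩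
    · by_contra hli
      exact hw (wedgeConics_eq_zero hli)
    · rw [Projectivization.map_mk]
      congr 1
      exact hBw.symm

/-! ### The minimal orbits are homogeneous -/

/-- The traceless matrices with image in `E` and kernel containing `E`. -/
def orbitPoint (E : Submodule ℂ (I4 → ℂ)) : Submodule ℂ (Sl I4) where
  carrier := {X | (∀ v, X.val *ᵥ v ∈ E) ∧ ∀ v ∈ E, X.val *ᵥ v = 0}
  zero_mem' := by simp
  add_mem' := by
    rintro X Y ⟨hX, hX0⟩ ⟨hY, hY0⟩
    refine ⟨fun v => ?_, fun v hv => ?_⟩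
    · simpa [Matrix.add_mulVec] using E.add_mem (hX v) (hY v)
    · simp [Matrix.add_mulVec, hX0 v hv, hY0 v hv]
  smul_mem' := by
    rintro t X ⟨hX, hX0⟩
    refine ⟨fun v => ?_, fun v hv => ?_⟩
    · simpa [Matrix.smul_mulVec] using E.smul_mem t (hX v)
    · simp [Matrix.smul_mulVec, hX0 v hv]

theorem mem_orbitPoint {E : Submodule ℂ (I4 → ℂ)} {X : Sl I4} :
    X ∈ orbitPoint E ↔ (∀ v, X.val *ᵥ v ∈ E) ∧ ∀ v ∈ E, X.val *ᵥ v = 0 := Iff.rfl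

theorem exists_eq_orbitPoint {m : ℕ} {a : Submodule ℂ (Sl I4)} (ha : a ∈ minimalOrbit m) :
    ∃ E : Submodule ℂ (I4 → ℂ), Module.finrank ℂ E = m ∧ a = orbitPoint E := by
  obtain ⟨E, hE, h⟩ := ha
  refine ⟨E, hE, ?_⟩
  ext X
  rw [h, mem_orbitPoint]
  refine and_congr ⟨fun h v => h ⟨v, rfl⟩, ?_⟩ Iff.rfl
  rintro h _ ⟨v, rfl⟩
  exact h v

theorem mem_sl_iff {M : Matrix I4 I4 ℂ} : M ∈ LieAlgebra.SpecialLinear.sl I4 ℂ ↔ M.trace = 0 := by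
  simp [LieAlgebra.SpecialLinear.sl]

theorem conj_mem_sl {P Q : Matrix I4 I4 ℂ} (h : Q * P = 1) (X : Sl I4) :
    P * X.val * Q ∈ LieAlgebra.SpecialLinear.sl I4 ℂ := by
  rw [mem_sl_iff, Matrix.trace_mul_comm, ← mul_assoc, h, one_mul, trace_val]

theorem conj_conj {P Q M : Matrix I4 I4 ℂ} (h : Q * P = 1) : Q * (P * M * Q) * P = M := by
  rw [show Q * (P * M * Q) * P = (Q * P) * M * (Q * P) by simp only [mul_assoc], h, one_mul,
    mul_one]

/-- Conjugation by an invertible matrix, as an automorphism of the Lie algebra of traceless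
matrices. -/
def conjSl (P Q : Matrix I4 I4 ℂ) (h : P * Q = 1) (h' : Q * P = 1) : Sl I4 ≃ₗ⁅ℂ⁆ Sl I4 where
  toFun X := ⟨P * X.val * Q, conj_mem_sl h' X⟩
  map_add' X Y := Subtype.ext (by simp [mul_add, add_mul])
  map_smul' t X := Subtype.ext (by simp)
  map_lie' {X Y} := Subtype.ext (by
    have key : ∀ M N : Matrix I4 I4 ℂ, P * (M * N) * Q = (P * M * Q) * (P * N * Q) := by
      intro M N
      rw [show (P * M * Q) * (P * N * Q) = P * M * (Q * P) * N * Q by simp only [mul_assoc], h',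
        mul_one]
      simp only [mul_assoc]
    simp only [LieSubalgebra.coe_bracket, Ring.lie_def, mul_sub, sub_mul, key])
  invFun X := ⟨Q * X.val * P, conj_mem_sl h X⟩
  left_inv X := Subtype.ext (conj_conj h')
  right_inv X := Subtype.ext (conj_conj h)

theorem neg_transpose_mem_sl (X : Sl I4) : -X.valᵀ ∈ LieAlgebra.SpecialLinear.sl I4 ℂ := by
  rw [mem_sl_iff, Matrix.trace_neg, Matrix.trace_transpose, trace_val, neg_zero]

/-- Minus the transpose, as an automorphism of the Lie algebra of traceless matrices. -/
def negTransposeSl : Sl I4 ≃ₗ⁅ℂ⁆ Sl I4 where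
  toFun X := ⟨-X.valᵀ, neg_transpose_mem_sl X⟩
  map_add' X Y := Subtype.ext (by
    change -(X.val + Y.val)ᵀ = -X.valᵀ + -Y.valᵀ
    rw [Matrix.transpose_add, neg_add])
  map_smul' t X := Subtype.ext (by
    change -(t • X.val)ᵀ = t • -X.valᵀ
    rw [Matrix.transpose_smul, smul_neg])
  map_lie' {X Y} := Subtype.ext (by
    change -(⁅X, Y⁆.val)ᵀ = ⁅-X.valᵀ, -Y.valᵀ⁆
    rw [LieAlgebra.SpecialLinear.sl_bracket, Ring.lie_def, Matrix.transpose_sub,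
      Matrix.transpose_mul, Matrix.transpose_mul, neg_mul_neg, neg_mul_neg, neg_sub])
  invFun X := ⟨-X.valᵀ, neg_transpose_mem_sl X⟩
  left_inv X := Subtype.ext (by
    change -(-X.valᵀ)ᵀ = X.val
    rw [Matrix.transpose_neg, Matrix.transpose_transpose, neg_neg])
  right_inv X := Subtype.ext (by
    change -(-X.valᵀ)ᵀ = X.val
    rw [Matrix.transpose_neg, Matrix.transpose_transpose, neg_neg])

theorem map_eq_of_forall {a b : Submodule ℂ (Sl I4)} (φ : Sl I4 ≃ₗ⁅ℂ⁆ Sl I4)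
    (h : ∀ X, φ X ∈ b ↔ X ∈ a) : a.map (φ : Sl I4 →ₗ[ℂ] Sl I4) = b := by
  ext Y
  constructor
  · rintro ⟨X, hX, rfl⟩
    exact (h X).mpr hX
  · intro hY
    refine ⟨φ.symm Y, (h _).mp ?_, φ.apply_symm_apply Y⟩
    rwa [φ.apply_symm_apply]

/-- An isomorphism from E to F extends to an automorphism of the whole space, and conjugation by it
does the rest. -/
theorem exists_map_orbitPoint {E F : Submodule ℂ (I4 → ℂ)}
    (h : Module.finrank ℂ E = Module.finrank ℂ F) :
    ∃ φ : Sl I4 ≃ₗ⁅ℂ⁆ Sl I4, (orbitPoint E).map (φ : Sl I4 →ₗ[ℂ] Sl I4) = orbitPoint F := by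
  obtain ⟨g, hg⟩ := Submodule.exists_linearEquiv_restrict_eq (LinearEquiv.ofFinrankEq E F h)
  have hgE : ∀ v, g v ∈ F ↔ v ∈ E := by
    intro v
    constructor
    · intro hv
      have := hg ((LinearEquiv.ofFinrankEq E F h).symm ⟨g v, hv⟩)
      rw [LinearEquiv.apply_symm_apply] at this
      rw [g.injective this]
      exact SetLike.coe_mem _
    · intro hv
      have := hg ⟨v, hv⟩
      rw [← this]
      exact SetLike.coe_mem _
  set P := LinearMap.toMatrix' (g : (I4 → ℂ) →ₗ[ℂ] (I4 → ℂ)) with hP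
  set Q := LinearMap.toMatrix' (g.symm : (I4 → ℂ) →ₗ[ℂ] (I4 → ℂ)) with hQ
  have hPv : ∀ v, P *ᵥ v = g v := fun v => LinearMap.toMatrix'_mulVec _ v
  have hQv : ∀ v, Q *ᵥ v = g.symm v := fun v => LinearMap.toMatrix'_mulVec _ v
  have hPQ : P * Q = 1 := by
    rw [hP, hQ, ← LinearMap.toMatrix'_comp]
    simp
  have hQP : Q * P = 1 := by
    rw [hP, hQ, ← LinearMap.toMatrix'_comp]
    simp
  refine ⟨conjSl P Q hPQ hQP, map_eq_of_forall _ fun X => ?_⟩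
  have hX : ∀ v, (conjSl P Q hPQ hQP X).val *ᵥ v = g (X.val *ᵥ g.symm v) := by
    intro v
    change (P * X.val * Q) *ᵥ v = _
    rw [← Matrix.mulVec_mulVec, ← Matrix.mulVec_mulVec, hPv, hQv]
  simp only [mem_orbitPoint, hX, hgE, map_eq_zero_iff g g.injective]
  refine and_congr ⟨fun h v => ?_, fun h v => h _⟩ ⟨fun h v hv => ?_, fun h v hv => ?_⟩
  · simpa using h (g v)
  · simpa using h (g v) ((hgE v).mpr hv)
  · exact h _ ((hgE _).mp (by simpa using hv))

/-! ### Coordinate subspaces -/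

/-- The vectors whose coordinates outside `s` are zero. -/
def coordSubspace (s : Set I4) : Submodule ℂ (I4 → ℂ) where
  carrier := {v | ∀ i, i ∉ s → v i = 0}
  zero_mem' := fun _ _ => rfl
  add_mem' hv hw i hi := by simp [hv i hi, hw i hi]
  smul_mem' t v hv i hi := by simp [hv i hi]

theorem mem_orbitPoint_coordSubspace {s : Set I4} {X : Sl I4} :
    X ∈ orbitPoint (coordSubspace s) ↔
      (∀ i, i ∉ s → ∀ j, X.val i j = 0) ∧ ∀ j ∈ s, ∀ i, X.val i j = 0 := by
  rw [mem_orbitPoint]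
  constructor
  · rintro ⟨h1, h2⟩
    refine ⟨fun i hi j => ?_, fun j hj i => ?_⟩
    · have : (X.val *ᵥ Pi.single j 1) i = 0 := h1 (Pi.single j 1) i hi
      simpa using this
    · have hs : (Pi.single j 1 : I4 → ℂ) ∈ coordSubspace s := by
        intro k hk
        refine Pi.single_eq_of_ne ?_ 1
        rintro rfl
        exact hk hj
      simpa using congrFun (h2 _ hs) i
  · rintro ⟨h1, h2⟩
    refine ⟨fun v i hi => ?_, fun v hv => ?_⟩
    · simp [Matrix.mulVec, dotProduct, h1 i hi]
    · ext i
      change ∑ j, X.val i j * v j = 0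
      refine Finset.sum_eq_zero fun j _ => ?_
      by_cases hj : j ∈ s
      · simp [h2 j hj i]
      · simp [hv j hj]

/-- Transposition exchanges the condition on rows (image) with that on columns (kernel), so it
carries the point of a hyperplane to the point of a line. -/
theorem map_negTransposeSl (s : Set I4) :
    (orbitPoint (coordSubspace s)).map (negTransposeSl : Sl I4 →ₗ[ℂ] Sl I4) =
      orbitPoint (coordSubspace sᶜ) := by
  refine map_eq_of_forall _ fun X => ?_
  have hX : ∀ i j, (negTransposeSl X).val i j = -X.val j i := fun _ _ => rfl
  simp only [mem_orbitPoint_coordSubspace, hX, neg_eq_zero, Set.mem_compl_iff, not_not]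
  exact and_comm

theorem chartPoint_zero : chartPoint 0 = orbitPoint (coordSubspace (Set.range Sum.inl)) := by
  ext X
  rw [mem_chartPoint, mem_orbitPoint_coordSubspace]
  constructor
  · rintro ⟨u, rfl⟩
    rw [chartLin_val]
    refine ⟨?_, ?_⟩
    · rintro (i | i) hi (j | j)
      · exact absurd ⟨i, rfl⟩ hi
      · exact absurd ⟨i, rfl⟩ hi
      · simp [chartMatrix, chartAlpha]
      · simp [chartMatrix, chartA, Matrix.trace]
    · rintro _ ⟨j, rfl⟩ (i | i)
      · simp [chartMatrix, chartA]
      · simp [chartMatrix, chartAlpha]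
  · rintro ⟨h1, h2⟩
    refine ⟨fun i => X.val (Sum.inl i) (Sum.inr ()), Subtype.ext ?_⟩
    rw [chartLin_val]
    ext (i | i) (j | j)
    · rw [h2 _ ⟨j, rfl⟩]
      simp [chartMatrix, chartA]
    · simp [chartMatrix]
    · rw [h2 _ ⟨j, rfl⟩]
      simp [chartMatrix, chartAlpha]
    · rw [h1 _ (by simp)]
      simp [chartMatrix, chartA, Matrix.trace]

theorem finrank_coordSubspace_inl :
    Module.finrank ℂ (coordSubspace (Set.range Sum.inl)) = 3 := by
  let e : coordSubspace (Set.range Sum.inl) ≃ₗ[ℂ] (Fin 3 → ℂ) :=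
    { toFun := fun v i => v.val (Sum.inl i)
      map_add' := fun _ _ => rfl
      map_smul' := fun _ _ => rfl
      invFun := fun u => ⟨Sum.elim u 0, by rintro (i | i) hi <;> simp at hi ⊢⟩
      left_inv := fun v => by
        ext (i | i)
        · rfl
        · exact (v.2 (Sum.inr i) (by simp)).symm
      right_inv := fun _ => rfl }
  rw [e.finrank_eq, Module.finrank_fin_fun]

theorem finrank_coordSubspace_compl_inl :
    Module.finrank ℂ (coordSubspace (Set.range Sum.inl)ᶜ) = 1 := by
  let e : coordSubspace (Set.range Sum.inl)ᶜ ≃ₗ[ℂ] (Unit → ℂ) :=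
    { toFun := fun v i => v.val (Sum.inr i)
      map_add' := fun _ _ => rfl
      map_smul' := fun _ _ => rfl
      invFun := fun u => ⟨Sum.elim 0 u, by rintro (i | i) hi <;> simp at hi ⊢⟩
      left_inv := fun v => by
        ext (i | i)
        · exact (v.2 (Sum.inl i) (by simp)).symm
        · rfl
      right_inv := fun _ => rfl }
  rw [e.finrank_eq]
  simp

theorem exists_map_chartPoint_zero {a : Submodule ℂ (Sl I4)}
    (ha : a ∈ minimalOrbit 1 ∪ minimalOrbit 3) :
    ∃ φ : Sl I4 ≃ₗ⁅ℂ⁆ Sl I4, (chartPoint 0).map (φ : Sl I4 →ₗ[ℂ] Sl I4) = a := by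
  rw [chartPoint_zero]
  rcases ha with ha | ha <;> obtain ⟨E, hE, rfl⟩ := exists_eq_orbitPoint ha
  · obtain ⟨φ, hφ⟩ := exists_map_orbitPoint (finrank_coordSubspace_compl_inl.trans hE.symm)
    refine ⟨negTransposeSl.trans φ, ?_⟩
    rw [← hφ, ← map_negTransposeSl, ← Submodule.map_comp]
    rfl
  · exact exists_map_orbitPoint (finrank_coordSubspace_inl.trans hE.symm)

/-- The origin is the slice point of the zero bivector. -/
theorem chartPoint_zero_mem_red : chartPoint 0 ∈ red I4 := by
  have h := chartPoint_sliceCoord_mem_red 0 0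
  have h0 : sliceCoord (minor (0 : Fin 6 → ℂ) 0) = 0 := by
    ext (t | t) <;> simp [sliceCoord, sliceAlpha, coneEntry, minor]
  rwa [h0] at h

theorem mem_red_of_mem_minimalOrbit {a : Submodule ℂ (Sl I4)}
    (ha : a ∈ minimalOrbit 1 ∪ minimalOrbit 3) : a ∈ red I4 := by
  obtain ⟨φ, rfl⟩ := exists_map_chartPoint_zero ha
  exact map_mem_red φ chartPoint_zero_mem_red

end ReductionVariety

end

theorem proposition23 :
    Module.finrank ℂ tracelessSym = 15 ∧
    ∃ T : ⋀[ℂ]^2 Conics ≃ₗ[ℂ] tracelessSym,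
      (∀ (e f : Module.Dual ℂ U) (u : U),
        (T (wedgeConics (sqForm e) (sqForm f))).val u *ᵥ u = (e u * f u) • wedgeVec e f) ∧
      (∀ (g : U ≃ₗ[ℂ] U) (ω : ⋀[ℂ]^2 Conics) (u v : U),
        (T (exteriorPower.map 2 (actConics g) ω)).val u *ᵥ v =
          (LinearMap.det (g : U →ₗ[ℂ] U))⁻¹ • g ((T ω).val (g.symm u) *ᵥ g.symm v)) ∧
      ∀ a ∈ minimalOrbit 1 ∪ minimalOrbit 3,
        a ∈ red I4 ∧
        (∃ φ : Sl I4 ≃ₗ⁅ℂ⁆ Sl I4, (chartPoint 0).map (φ : Sl I4 →ₗ[ℂ] Sl I4) = a) ∧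
        ∀ φ : Sl I4 ≃ₗ⁅ℂ⁆ Sl I4, (chartPoint 0).map (φ : Sl I4 →ₗ[ℂ] Sl I4) = a →
          (tangentConeIdeal (redSlice φ) 0).IsPrime ∧
          HasProjectiveDimension (tangentConeIdeal (redSlice φ) 0) 8 ∧
          tangentCone (redSlice φ) 0 ⊆ Set.range toChart ∧
          Projectivization.map T.toLinearMap T.injective '' pencils = C4 φ :=

  ⟨finrank_tracelessSym, bivectorEquiv, bivectorEquiv_sqForm, bivectorEquiv_map, fun _ ha =>
    ⟨mem_red_of_mem_minimalOrbit ha, exists_map_chartPoint_zero ha, fun φ _ =>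
      ⟨tangentConeIdeal_redSlice φ ▸ isPrime_vanishingIdeal_coneSet,
        tangentConeIdeal_redSlice φ ▸ hasProjectiveDimension_coneSet,
        tangentCone_redSlice_subset φ, image_pencils φ⟩⟩⟩
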